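/- Let $k\ge 4$, let $\binom{[k]}{2}$ be the set of two-element subsets of $\{1,\dots,k\}$, and let $R$ be an arbitrary $k$-vertex tournament whose $\binom k2$ edges are colored with the $\binom k2$ distinct colors from $\binom{[k]}{2}$ (each color is used exactly once). For a tournament $H$ whose edges are colored with colors from $\binom{[k]}{2}$, let $i(R;H)$ be the number of copies of $R$ in $H$, that is, the number of $k$-element sets of vertices of $H$ on which $H$ induces a colored tournament isomorphic to $R$ (with the same orientations and the same colors). Then the inducibility $$i(R)=\lim_{s\to\infty}\ \max_{|V(H)|=s}\frac{i(R;H)}{\binom sk},$$ where the maximum is over all $s$-vertex tournaments $H$ with edges colored from $\binom{[k]}{2}$, exists and satisfies $$i(R)=\frac{k!}{k^k-k}.$$ Moreover, this value is equal to $\lim_{s\to\infty} g_k(s)/\binom sk$ (in particular this limit exists), where $g_k(s)=0$ for $0\le s<k$ and, for $s\ge k$, $g_k(s)$ is the maximum of $\sum_{i=1}^k g_k(s_i)+\prod_{i=1}^k s_i$ over all integers $s_1,\dots,s_k$ with $s_1+\cdots+s_k=s$ and $0\le s_i<s$ for each $i$. -/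

import Mathlib

open Filter Topology

/-- A tournament on the vertex set `V` whose edges are colored with colors from `C`: every pair of
distinct vertices carries exactly one of the two orientations, and one color. -/
structure ColoredTournament (V C : Type*) where
  /-- `arc u v` says that the edge between `u` and `v` is oriented from `u` to `v`. -/
  arc : V → V → Prop
  arc_irrefl : ∀ v, ¬ arc v v
  arc_total : ∀ u v, u ≠ v → arc u v ∨ arc v u
  arc_asymm : ∀ u v, arc u v → ¬ arc v u
  /-- The color of each (unordered) edge of the complete graph on `V`. -/
  color : SimpleGraph.TopEdgeLabeling V C

namespace ColoredTournament

/-- The vertex set `S` spans a copy of `R` in `H`: some bijection from the vertices of `R` onto `S`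
preserves the orientation and the color of every edge. -/
def IsCopy {V W C : Type*} (R : ColoredTournament V C) (H : ColoredTournament W C)
    (S : Finset W) : Prop :=
  ∃ f : V ↪ W, Set.range f = (S : Set W) ∧
    (∀ u v, H.arc (f u) (f v) ↔ R.arc u v) ∧ H.color.pullback f = R.color

/-- The number of copies of `R` in `H`. -/
noncomputable def numCopies {V W C : Type*} (R : ColoredTournament V C)
    (H : ColoredTournament W C) : ℕ :=
  {S : Finset W | R.IsCopy H S}.ncard

/-- The maximum number of copies of `R` in a colored tournament on `s` vertices. -/
noncomputable def maxCopies {V C : Type*} (R : ColoredTournament V C) (s : ℕ) : ℕ :=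
  sSup {n : ℕ | ∃ H : ColoredTournament (Fin s) C, R.numCopies H = n}

/-- The supremum in the definition of `maxCopies` is a genuine maximum. -/
theorem maxCopies_isGreatest {V C : Type*} [Nonempty C] (R : ColoredTournament V C) (s : ℕ) :
    IsGreatest {n : ℕ | ∃ H : ColoredTournament (Fin s) C, R.numCopies H = n}
      (R.maxCopies s) := by
  have hbdd : BddAbove {n : ℕ | ∃ H : ColoredTournament (Fin s) C, R.numCopies H = n} := by
    refine ⟨(Set.univ : Set (Finset (Fin s))).ncard, ?_⟩
    rintro n ⟨H, rfl⟩
    exact Set.ncard_le_ncard (Set.subset_univ _) Set.finite_univ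
  have hne : {n : ℕ | ∃ H : ColoredTournament (Fin s) C, R.numCopies H = n}.Nonempty :=
    ⟨_, ⟨fun u v => u < v, fun v => lt_irrefl v, fun _ _ h => lt_or_gt_of_ne h,
      fun _ _ h => h.not_gt, fun _ => Classical.arbitrary C⟩, rfl⟩
  exact ⟨Nat.sSup_mem hne hbdd, fun n hn => le_csSup hbdd hn⟩

/-- The inducibility of the tournament `R` on the finite vertex set `V` exists and equals `a`:
the maximum density of copies of `R` in colored tournaments on `s` vertices tends to `a`
as `s → ∞`. -/
def HasInducibility {V C : Type*} [Fintype V] (R : ColoredTournament V C) (a : ℝ) : Prop :=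
  Tendsto (fun s : ℕ => (R.maxCopies s : ℝ) / (s.choose (Fintype.card V) : ℝ)) atTop (𝓝 a)

end ColoredTournament

/-- The color set `[k] choose 2` of all two-element subsets of `{1, …, k}`. -/
abbrev PairColor (k : ℕ) : Type := {c : Finset (Fin k) // c.card = 2}

/-- The function `g_k(s)`: it is `0` for `s < k`, and for `s ≥ k` it is the maximum of
`∑ i, g_k(s_i) + ∏ i, s_i` over all `s_1 + ⋯ + s_k = s` with `0 ≤ s_i < s` for each `i`. -/
def recursiveEdges (k s : ℕ) : ℕ :=
  if s < k then 0 else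
    (Finset.univ.filter (fun p : Fin k → Fin s => ∑ i, (p i : ℕ) = s)).sup
      (fun p => ∑ i, recursiveEdges k (p i : ℕ) + ∏ i, (p i : ℕ))
termination_by s
decreasing_by exact (p i).isLt

/-!
The argument sandwiches both sequences between two explicit functions of the number `n` of vertices:

  `max (n - 2 * k) 0 ^ k / (k ^ k - k) ≤ recursiveEdges k n ≤ maxCopies R n ≤ n ^ k / (k ^ k - k)`.

The lower bounds are constructions. Replacing the vertices of `R` by extremal tournaments of sizes
`s i` gives a colored tournament with all copies inside the parts and with `∏ s i` further copies
(`recursiveEdges_le_maxCopies`), and balanced partitions show that `recursiveEdges` has the right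
growth (`le_recursiveEdges`).

The upper bound `n ^ k / (k ^ k - k)` is proved by induction on `n`, with no error terms
(`card_labeledCopies_le`). Since all edges of `R` have different colors, the color and the
orientation of an edge `u v` of `H` determine the vertices of `R` that `u` and `v` correspond to in
any copy through both; call them the labels of `u` and of `v` in this pair. Thus copies are the
injections `τ` from the vertices of `R` for which `τ a` has the label `a` towards each other `τ b`.

Suppose that the bound fails for `n` but holds for smaller numbers. Then every vertex `u` lies in at
least `(n - 1) ^ (k - 1) / (k ^ (k - 1) - 1)` copies. By the arithmetic-geometric mean inequality,
`u` plays the role `a` in at most `(d a / (k - 1)) ^ (k - 1)` copies, where `d a` is the number of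
vertices towards which `u` has the label `a`. Together these force `u` to have one dominant label,
that is, the same label towards all but about `n / k` vertices (`exists_dominant_label`). The
dominant labels partition the vertices into classes `P i`. A copy is of one of three kinds:

* all its vertices play their dominant roles, so that it is a transversal of the classes;
* it lies inside a single class;
* neither. Such a copy contains at least `k - 2` wrong pairs, i.e. pairs between different classes
  in which one of the labels is not dominant (`two_mul_le_card_cross_pairs`).

A wrong pair lies in few copies, as its vertex with the minority label sees only about `n / k`
vertices with that label (`two_mul_card_bad_le`). On the other hand, if `e` is the largest density
of wrong pairs between two classes, at least the fraction `e` of all transversals contains a wrong pair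
and is not a copy (`prod_mul_card_wrongPairs_le`). Copies with a vertex outside its dominant role
are rare (`card_misaligned_le`), so there are many transversals, and the numerical inequality
`minorityBound_pow_add_pow_le` shows that the transversals lost are at least as many as the copies
of the third kind. So there are at most `∏ #(P i) + ∑ #(P i) ^ k / (k ^ k - k)` copies,
which is at most `n ^ k / (k ^ k - k)` by `prod_add_sum_pow_le_sum_pow`.
-/

/-! ### Inequalities -/

section Inequalities

open Finset

/-- The inequality of arithmetic and geometric means, without roots. -/
theorem prod_le_mean_pow_card {ι : Type*} (s : Finset ι) (z : ι → ℝ) (hz : ∀ i ∈ s, 0 ≤ z i) :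
    ∏ i ∈ s, z i ≤ ((∑ i ∈ s, z i) / #s) ^ #s := by
  rcases s.eq_empty_or_nonempty with rfl | hs
  · simp
  have hc : #s ≠ 0 := hs.card_ne_zero
  have h := Real.geom_mean_le_arith_mean s (fun _ => 1) z (fun _ _ => zero_le_one)
    (by simpa using hs.card_pos) hz
  simp only [Real.rpow_one, sum_const, nsmul_eq_mul, mul_one, one_mul] at h
  calc ∏ i ∈ s, z i = ((∏ i ∈ s, z i) ^ ((#s : ℝ)⁻¹)) ^ #s :=
        (Real.rpow_inv_natCast_pow (prod_nonneg hz) hc).symm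
    _ ≤ _ := pow_le_pow_left₀ (Real.rpow_nonneg (prod_nonneg hz) _) h _

theorem card_filter_exists_forall_eq (ι : Type*) [Fintype ι] [Nonempty ι] [DecidableEq ι] :
    #{f : ι → ι | ∃ a, ∀ j, f j = a} = Fintype.card ι := by
  have : ({f : ι → ι | ∃ a, ∀ j, f j = a} : Finset (ι → ι)) = univ.image (fun a _ => a) := by
    ext f
    simp [funext_iff, eq_comm]
  rw [this, card_image_of_injective _ fun a b h => congrFun h (Classical.arbitrary ι), card_univ]

/-- Expand `(∑ y) ^ k` into the monomials `∏ j, y (f j)` with `f : ι → ι`. The constant `f` give the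
powers `y i ^ k`. For any other `f`, the arithmetic mean of the monomials of the `k` translates of
`f` is at least their geometric mean, which is `∏ y`. -/
theorem prod_add_sum_pow_le_sum_pow {ι : Type*} [Fintype ι] [Nonempty ι] (y : ι → ℝ)
    (hy : ∀ i, 0 ≤ y i) :
    ((Fintype.card ι : ℝ) ^ Fintype.card ι - Fintype.card ι) * ∏ i, y i
      + ∑ i, y i ^ Fintype.card ι ≤ (∑ i, y i) ^ Fintype.card ι := by
  classical
  set k := Fintype.card ι with hk
  have hk0 : 0 < k := Fintype.card_pos
  have : NeZero k := ⟨hk0.ne'⟩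
  let _ : AddCommGroup ι := (Fintype.equivFin ι).addCommGroup
  let z : (ι → ι) → ℝ := fun f => ∏ j, y (f j)
  have hz0 : ∀ f, 0 ≤ z f := fun f => prod_nonneg fun _ _ => hy _
  have hmean : ∀ f : ι → ι, k * ∏ i, y i ≤ ∑ c, z (fun j => f j + c) := by
    intro f
    have h := prod_le_mean_pow_card univ (fun c => z fun j => f j + c) fun c _ => hz0 _
    have hprod : ∏ c, z (fun j => f j + c) = (∏ i, y i) ^ k := by
      simp only [z]
      rw [Finset.prod_comm]
      have : ∀ j, ∏ c, y (f j + c) = ∏ i, y i := fun j =>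
        Fintype.prod_equiv (Equiv.addLeft (f j)) _ _ fun _ => rfl
      simp [this, hk]
    rw [hprod, card_univ, ← hk, pow_le_pow_iff_left₀ (prod_nonneg fun i _ => hy i)
      (div_nonneg (sum_nonneg fun _ _ => hz0 _) (Nat.cast_nonneg _)) hk0.ne',
      le_div_iff₀ (by exact_mod_cast hk0)] at h
    linarith
  have hexp : (∑ i, y i) ^ k = ∑ f : ι → ι, z f := by
    have := Finset.prod_univ_sum (fun _ : ι => (univ : Finset ι)) (fun _ i => y i)
    simpa [hk] using this
  have hconst : ∑ f ∈ univ.filter (fun f : ι → ι => ∃ a, ∀ j, f j = a), z f = ∑ i, y i ^ k := by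
    have : ({f : ι → ι | ∃ a, ∀ j, f j = a} : Finset (ι → ι)) = univ.image (fun a _ => a) := by
      ext f
      simp [funext_iff, eq_comm]
    rw [this, sum_image fun a _ b _ h => congrFun h (Classical.arbitrary ι)]
    simp [z, hk]
  have hshift : ∀ c : ι, ∑ f ∈ univ.filter (fun f : ι → ι => ¬ ∃ a, ∀ j, f j = a),
      z (fun j => f j + c) = ∑ f ∈ univ.filter (fun f : ι → ι => ¬ ∃ a, ∀ j, f j = a), z f := by
    intro c
    refine sum_equiv (Equiv.addRight (fun _ => c)) (fun f => ?_) fun f _ => rfl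
    simp only [mem_filter, mem_univ, true_and, Equiv.coe_addRight, Pi.add_apply]
    refine not_congr ⟨fun ⟨a, ha⟩ => ⟨a + c, fun j => by rw [ha]⟩,
      fun ⟨a, ha⟩ => ⟨a - c, fun j => by rw [← ha j, add_sub_cancel_right]⟩⟩
  have hcard : (#(univ.filter (fun f : ι → ι => ¬ ∃ a, ∀ j, f j = a)) : ℝ) = (k : ℝ) ^ k - k := by
    have h1 := card_filter_add_card_filter_not (s := (univ : Finset (ι → ι)))
      (fun f => ∃ a, ∀ j, f j = a)
    rw [card_filter_exists_forall_eq, card_univ, Fintype.card_fun, ← hk] at h1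
    rw [eq_sub_iff_add_eq, add_comm]
    exact_mod_cast h1
  have hnon : ((k : ℝ) ^ k - k) * ∏ i, y i
      ≤ ∑ f ∈ univ.filter (fun f : ι → ι => ¬ ∃ a, ∀ j, f j = a), z f := by
    have h1 : ∑ f ∈ univ.filter (fun f : ι → ι => ¬ ∃ a, ∀ j, f j = a), (k * ∏ i, y i)
        ≤ ∑ f ∈ univ.filter (fun f : ι → ι => ¬ ∃ a, ∀ j, f j = a),
          ∑ c, z (fun j => f j + c) := sum_le_sum fun f _ => hmean f
    rw [sum_comm, sum_congr rfl (fun c _ => hshift c), sum_const, sum_const, nsmul_eq_mul,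
      nsmul_eq_mul, hcard, card_univ, ← hk] at h1
    have hk' : (0 : ℝ) < k := by exact_mod_cast hk0
    nlinarith
  rw [hexp, ← sum_filter_add_sum_filter_not univ (fun f : ι → ι => ∃ a, ∀ j, f j = a), hconst]
  linarith

/-- A bound on the fraction of the vertices that a vertex of high degree may see outside its
dominant label. The value `3 / (2 * k)` is valid for `k = 4` as well, but there it would be too
large for `minorityBound_pow_add_pow_le`. -/
noncomputable def minorityBound (k : ℕ) : ℝ := if k = 4 then 21 / 80 else 3 / (2 * k)

theorem minorityBound_nonneg (k : ℕ) : 0 ≤ minorityBound k := by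
  unfold minorityBound; split_ifs <;> positivity

/-- The numerical inequality on which the bound rests. With `n` vertices, the second term times
`n ^ k` bounds the number of copies with a vertex outside its dominant role. What it leaves of
`n ^ k / (k ^ k - k)` bounds the number `p` of transversals from below. The first term times `n ^ k`
is a number `q` such that the copies through wrong pairs are at most `q / p` times as many as the
transversals through wrong pairs. So the inequality gives `q ≤ p`. -/
theorem minorityBound_pow_add_pow_le {k : ℕ} (hk : 4 ≤ k) :
    (minorityBound k / (k - 2)) ^ (k - 2) * ((k - 1) / (2 * k * (k - 2)))
      + (minorityBound k / (k - 1)) ^ (k - 1) ≤ 1 / ((k : ℝ) ^ k - k) := by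
  rcases eq_or_lt_of_le hk with rfl | h5
  · norm_num [minorityBound]
  obtain ⟨n, rfl⟩ : ∃ n, k = n + 5 := ⟨k - 5, by omega⟩
  have e2 : n + 5 - 2 = n + 3 := by omega
  have e1 : n + 5 - 1 = n + 4 := by omega
  have hω : minorityBound (n + 5) = 3 / 2 / ((n + 5 : ℕ) : ℝ) := by
    rw [minorityBound, if_neg (by omega), div_div]
  rw [e2, e1, hω]
  push_cast
  have hn : (0 : ℝ) ≤ n := Nat.cast_nonneg n
  set K : ℝ := (n : ℝ) + 5 with hK
  have hK5 : 5 ≤ K := by linarith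
  have hpow : ∀ j : ℕ, (j : ℝ) + 5 ≤ 5 / 16 * 2 ^ (j + 4) ∧ (j : ℝ) + 7 ≤ 7 / 16 * 2 ^ (j + 4) := by
    intro j
    induction j with
    | zero => norm_num
    | succ j ih =>
      push_cast
      have : (1 : ℝ) ≤ 2 ^ (j + 4) := one_le_pow₀ (by norm_num)
      rw [show j + 1 + 4 = (j + 4) + 1 by ring, pow_succ]
      constructor <;> nlinarith [ih.1, ih.2]
  obtain ⟨hp1, hp2⟩ := hpow n
  have hA : (3 / 2 / (K - 2)) ^ (n + 3) ≤ (1 / 2) ^ (n + 3) := by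
    apply pow_le_pow_left₀ (div_nonneg (by norm_num) (by linarith))
    rw [div_le_div_iff₀ (by linarith) (by norm_num)]
    linarith
  have hB : (3 / 2 / (K - 1)) ^ (n + 4) ≤ (1 / 2) ^ (n + 4) := by
    apply pow_le_pow_left₀ (div_nonneg (by norm_num) (by linarith))
    rw [div_le_div_iff₀ (by linarith) (by norm_num)]
    linarith
  have h1 : (3 / 2 / K / (K - 2)) ^ (n + 3) * ((K - 1) / (2 * K * (K - 2)))
      ≤ 7 / 16 / K ^ (n + 5) := by
    have e : (3 / 2 / K / (K - 2)) ^ (n + 3) * ((K - 1) / (2 * K * (K - 2)))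
        = (3 / 2 / (K - 2)) ^ (n + 3) * (K * (K - 1) / (2 * (K - 2))) / K ^ (n + 5) := by
      rw [div_right_comm, div_pow _ K, show K ^ (n + 5) = K ^ (n + 3) * K ^ 2 by ring]
      have : K - 2 ≠ 0 := by linarith
      have : K ≠ 0 := by linarith
      field_simp
    rw [e]
    apply div_le_div_of_nonneg_right _ (by positivity)
    have hq : K * (K - 1) / (2 * (K - 2)) ≤ (K + 2) / 2 := by
      rw [div_le_div_iff₀ (by linarith) (by norm_num)]
      nlinarith
    calc _ ≤ (1 / 2) ^ (n + 3) * ((K + 2) / 2) :=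
          mul_le_mul hA hq (div_nonneg (by nlinarith) (by linarith)) (by positivity)
      _ = (n + 7) / 2 ^ (n + 4) := by
          rw [hK, one_div, inv_pow, pow_succ 2 (n + 3)]; field_simp; ring
      _ ≤ 7 / 16 := by rw [div_le_iff₀ (by positivity)]; exact hp2
  have h2 : (3 / 2 / K / (K - 1)) ^ (n + 4) ≤ 5 / 16 / K ^ (n + 5) := by
    have e : (3 / 2 / K / (K - 1)) ^ (n + 4) = (3 / 2 / (K - 1)) ^ (n + 4) * K / K ^ (n + 5) := by
      rw [div_right_comm, div_pow _ K, pow_succ K (n + 4)]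
      have : K ≠ 0 := by linarith
      field_simp
    rw [e]
    apply div_le_div_of_nonneg_right _ (by positivity)
    calc _ ≤ (1 / 2) ^ (n + 4) * K := mul_le_mul_of_nonneg_right hB (by linarith)
      _ = (n + 5) / 2 ^ (n + 4) := by rw [hK, one_div, inv_pow]; field_simp
      _ ≤ 5 / 16 := by rw [div_le_iff₀ (by positivity)]; exact hp1
  have hlt : K < K ^ (n + 5) := lt_self_pow₀ (by linarith) (by omega)
  have h3 : 1 / K ^ (n + 5) ≤ 1 / (K ^ (n + 5) - K) :=
    one_div_le_one_div_of_le (by linarith) (by linarith)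
  have h4 : 7 / 16 / K ^ (n + 5) + 5 / 16 / K ^ (n + 5) ≤ 1 / K ^ (n + 5) := by
    rw [← add_div]
    exact div_le_div_of_nonneg_right (by norm_num) (by positivity)
  linarith

/-- If the power sum `∑ x ^ (k - 1)` is as large as the degree of a vertex of an extremal structure
demands, then a single one of the `x i` carries almost all of the total mass `m`. -/
theorem exists_sub_le_minorityBound {ι : Type*} [Fintype ι] {k : ℕ} (hk : 4 ≤ k) (x : ι → ℝ)
    (hx : ∀ i, 0 ≤ x i) {m : ℝ} (hm : 0 < m) (hsum : ∑ i, x i = m)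
    (h : ((k : ℝ) - 1) ^ (k - 1) * (m ^ (k - 1) / ((k : ℝ) ^ (k - 1) - 1)) ≤ ∑ i, x i ^ (k - 1)) :
    ∃ i, m - x i ≤ minorityBound k * m := by
  classical
  have hne : (univ : Finset ι).Nonempty := by
    rw [nonempty_iff_ne_empty]
    intro h0
    rw [h0, sum_empty] at hsum
    exact hm.ne hsum
  obtain ⟨i, -, hi⟩ := exists_max_image univ x hne
  refine ⟨i, ?_⟩
  have hk4 : (4 : ℝ) ≤ k := by exact_mod_cast hk
  obtain ⟨n, rfl⟩ : ∃ n, k = n + 2 := ⟨k - 2, by omega⟩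
  have e1 : n + 2 - 1 = n + 1 := by omega
  rw [e1] at h
  push_cast at h hk4
  set K : ℝ := (n : ℝ) + 2 with hK
  have hxm : x i ≤ m := hsum ▸ single_le_sum (fun j _ => hx j) (mem_univ i)
  have hcrude : m - x i ≤ 3 / (2 * K) * m := by
    by_contra! hlt
    have h1 : ∑ j, x j ^ (n + 1) ≤ x i ^ n * m := by
      rw [← hsum, mul_sum]
      refine sum_le_sum fun j _ => ?_
      rw [pow_succ]
      exact mul_le_mul_of_nonneg_right (pow_le_pow_left₀ (hx j) (hi j (mem_univ j)) n) (hx j)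
    have h2 : x i ≤ (1 - 3 / (2 * K)) * m := by linarith
    have h3 : x i ^ n * m ≤ (1 - 3 / (2 * K)) ^ n * m ^ (n + 1) := by
      rw [pow_succ, ← mul_assoc, ← mul_pow]
      exact mul_le_mul_of_nonneg_right (pow_le_pow_left₀ (hx i) h2 n) hm.le
    have h4 : (1 - 3 / (2 * K)) ^ n ≤ (1 - 1 / K) ^ (n + 1) := by
      have hb := one_add_mul_le_pow (a := 1 / (2 * K - 3))
        (le_trans (by norm_num) (div_nonneg zero_le_one (by linarith : (0 : ℝ) ≤ 2 * K - 3))) n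
      have hc : 1 + 1 / (K - 1) ≤ 1 + n * (1 / (2 * K - 3)) := by
        rw [mul_one_div, show (n : ℝ) = K - 2 by rw [hK]; ring]
        apply add_le_add_right
        rw [div_le_div_iff₀ (by linarith) (by linarith)]
        nlinarith
      have hfac : 1 - 1 / K = (1 - 3 / (2 * K)) * (1 + 1 / (2 * K - 3)) := by
        have hK3 : 2 * K - 3 ≠ 0 := by linarith
        have : K ≠ 0 := by linarith
        rw [show 1 + 1 / (2 * K - 3) = (2 * K - 2) / (2 * K - 3) by rw [one_add_div hK3]; ring,
          show 1 - 3 / (2 * K) = (2 * K - 3) / (2 * K) by field_simp, div_mul_div_cancel₀' hK3]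
        field_simp
      have hp : 0 ≤ (1 - 3 / (2 * K)) ^ n := by
        apply pow_nonneg
        rw [sub_nonneg, div_le_one (by linarith)]
        linarith
      have hone : (1 + 1 / (K - 1)) * (1 - 1 / K) = 1 := by
        have : K - 1 ≠ 0 := by linarith
        have : K ≠ 0 := by linarith
        field_simp
        ring
      have hnn : 0 ≤ 1 - 1 / K := by
        rw [sub_nonneg, div_le_one (by linarith)]
        linarith
      calc (1 - 3 / (2 * K)) ^ n = (1 - 3 / (2 * K)) ^ n * ((1 + 1 / (K - 1)) * (1 - 1 / K)) := by
            rw [hone, mul_one]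
        _ ≤ (1 - 3 / (2 * K)) ^ n * ((1 + 1 / (2 * K - 3)) ^ n * (1 - 1 / K)) :=
            mul_le_mul_of_nonneg_left (mul_le_mul_of_nonneg_right (hc.trans hb) hnn) hp
        _ = (1 - 1 / K) ^ (n + 1) := by rw [← mul_assoc, ← mul_pow, ← hfac, pow_succ]
    have h5 : (1 - 1 / K) ^ (n + 1) * m ^ (n + 1)
        < (K - 1) ^ (n + 1) * (m ^ (n + 1) / (K ^ (n + 1) - 1)) := by
      have hK0 : K ≠ 0 := by linarith
      have e : 1 - 1 / K = (K - 1) / K := by field_simp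
      have hKp : 1 < K ^ (n + 1) := one_lt_pow₀ (by linarith) (by omega)
      rw [e, div_pow, div_mul_eq_mul_div, mul_div_assoc']
      apply div_lt_div_of_pos_left _ (by linarith) (by linarith)
      exact mul_pos (pow_pos (by linarith) _) (pow_pos hm _)
    have h6 := mul_le_mul_of_nonneg_right h4 (pow_nonneg hm.le (n + 1))
    linarith
  rw [minorityBound]
  split_ifs with h4
  · -- For `k = 4` the crude bound `3 / 8` is improved through `∑ x ^ 3 ≤ m ^ 3 - 3 m (m - w) w`.
    obtain rfl : n = 2 := by omega
    have hK4 : K = 4 := by rw [hK]; norm_num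
    rw [hK4] at hcrude h
    norm_num at h hcrude ⊢
    set w := m - x i with hw
    have hw0 : 0 ≤ w := by linarith
    have hrest : ∑ j ∈ univ.erase i, x j = w := by
      rw [hw, ← hsum, ← add_sum_erase univ x (mem_univ i)]; ring
    have h3 : ∑ j ∈ univ.erase i, x j ^ 3 ≤ w ^ 3 := by
      calc _ ≤ ∑ j ∈ univ.erase i, w ^ 2 * x j := by
            refine sum_le_sum fun j hj => ?_
            have : x j ≤ w := hrest ▸ single_le_sum (fun l _ => hx l) hj
            rw [pow_succ]
            exact mul_le_mul_of_nonneg_right (pow_le_pow_left₀ (hx j) this 2) (hx j)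
        _ = w ^ 3 := by rw [← mul_sum, hrest]; ring
    rw [← add_sum_erase univ _ (mem_univ i)] at h
    have hxi : x i = m - w := by rw [hw]; ring
    rw [hxi] at h
    have h7 : m * (21 * (m - w) * w - 4 * m ^ 2) ≤ 0 := by nlinarith
    have h8 : 21 * (m - w) * w ≤ 4 * m ^ 2 := by
      by_contra! hc
      nlinarith [mul_pos hm (sub_pos.2 hc)]
    by_contra! hc
    nlinarith [mul_nonneg (sub_nonneg.2 hcrude) (sub_nonneg.2 hc.le), mul_pos hm hm]
  · push_cast
    exact hcrude

/-- The degree that a vertex must have, or else it can be deleted. -/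
theorem pow_div_le_pow_div_sub {k : ℕ} (hk : 2 ≤ k) {n : ℝ} (hn : 1 ≤ n) :
    (n - 1) ^ (k - 1) / ((k : ℝ) ^ (k - 1) - 1)
      ≤ n ^ k / ((k : ℝ) ^ k - k) - (n - 1) ^ k / ((k : ℝ) ^ k - k) := by
  obtain ⟨j, rfl⟩ : ∃ j, k = j + 1 := ⟨k - 1, by omega⟩
  rw [Nat.add_sub_cancel]
  set K : ℝ := ((j + 1 : ℕ) : ℝ) with hK
  have hK2 : 2 ≤ K := by rw [hK]; exact_mod_cast hk
  have h1 : 1 < K ^ j := one_lt_pow₀ (by linarith) (by omega)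
  have e : K ^ (j + 1) - K = K * (K ^ j - 1) := by ring
  have hp : K * (n - 1) ^ j ≤ n ^ (j + 1) - (n - 1) ^ (j + 1) := by
    have := pow_add_mul_le_add_pow (a := n - 1) (b := 1) (by linarith) (by linarith) (j + 1)
    rw [Nat.add_sub_cancel] at this
    simp only [mul_one, sub_add_cancel] at this
    rw [hK]
    linarith
  rw [e, ← sub_div, div_le_div_iff₀ (by linarith) (by nlinarith)]
  nlinarith [mul_le_mul_of_nonneg_right hp (by linarith : 0 ≤ K ^ j - 1)]

end Inequalities

/-! ### Labeled copies -/

section CrossPairs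

open Finset

/-- Let `g : ι → ι` be neither constant nor the identity. A non-fixed point `a` of `g` and its fibre
`{x | g x = g a}`, of size `s` say, yield at least `max 1 (s - 1) * (k - s) ≥ k - 2` pairs of a
non-fixed point in the fibre and a point outside; each is counted in both orders. -/
theorem two_mul_le_card_cross_pairs {ι : Type*} [Fintype ι] [DecidableEq ι]
    (g : ι → ι) (hconst : ¬ ∃ i, ∀ a, g a = i) (hid : ∃ a, g a ≠ a) :
    2 * (Fintype.card ι - 2)
      ≤ #{q : ι × ι | g q.1 ≠ g q.2 ∧ (g q.1 ≠ q.1 ∨ g q.2 ≠ q.2)} := by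
  obtain ⟨a, ha⟩ := hid
  set C : Finset ι := {x | g x = g a} with hC
  set M : Finset ι := C.erase (g a) with hM
  set W : Finset (ι × ι) := {q : ι × ι | g q.1 ≠ g q.2 ∧ (g q.1 ≠ q.1 ∨ g q.2 ≠ q.2)} with hW
  have hmis : ∀ x ∈ M, g x ≠ x := by
    intro x hx h
    simp only [hM, hC, mem_erase, mem_filter, mem_univ, true_and] at hx
    exact hx.1 (by rw [← hx.2, h])
  have haM : a ∈ M := by simp [hM, hC, ha.symm]
  have h1 : M ×ˢ Cᶜ ⊆ W := by
    rintro ⟨x, y⟩ h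
    rw [mem_product] at h
    have hx := hmis x h.1
    simp only [hM, hC, mem_erase, mem_filter, mem_univ, true_and, mem_compl] at h
    simp only [hW, mem_filter, mem_univ, true_and]
    exact ⟨fun e => h.2 (by rw [← e, h.1.2]), Or.inl hx⟩
  have h2 : Cᶜ ×ˢ M ⊆ W := by
    rintro ⟨y, x⟩ h
    rw [mem_product] at h
    have hx := hmis x h.2
    simp only [hM, hC, mem_erase, mem_filter, mem_univ, true_and, mem_compl] at h
    simp only [hW, mem_filter, mem_univ, true_and]
    exact ⟨fun e => h.1 (by rw [e, h.2.2]), Or.inr hx⟩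
  have hdisj : Disjoint (M ×ˢ Cᶜ) (Cᶜ ×ˢ M) := by
    rw [disjoint_left]
    rintro ⟨x, y⟩ h h'
    rw [mem_product] at h h'
    exact (mem_compl.1 h'.1) (erase_subset _ _ h.1)
  have hcard : #M * #Cᶜ + #Cᶜ * #M ≤ #W := by
    rw [← card_product, ← card_product, ← card_union_of_disjoint hdisj]
    exact card_le_card (union_subset h1 h2)
  have hM1 : 1 ≤ #M := card_pos.2 ⟨a, haM⟩
  have hM2 : #C - 1 ≤ #M := pred_card_le_card_erase
  have hCc : 1 ≤ #Cᶜ := by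
    rw [Nat.one_le_iff_ne_zero, card_ne_zero]
    by_contra h
    rw [not_nonempty_iff_eq_empty, compl_eq_empty_iff] at h
    refine hconst ⟨g a, fun x => ?_⟩
    have : x ∈ C := h ▸ mem_univ x
    simpa [hC] using this
  have hsum : #C + #Cᶜ = Fintype.card ι := card_add_card_compl C
  have : Fintype.card ι - 2 ≤ #M * #Cᶜ := by
    obtain ⟨s, hs⟩ : ∃ s, #M = s + 1 := ⟨#M - 1, by omega⟩
    obtain ⟨t, ht⟩ : ∃ t, #Cᶜ = t + 1 := ⟨#Cᶜ - 1, by omega⟩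
    rw [hs, ht]
    have : (s + 1) * (t + 1) = s * t + s + t + 1 := by ring
    omega
  rw [mul_comm #Cᶜ] at hcard
  omega

end CrossPairs

section Labelings

open Finset

variable {ι U : Type*} [Fintype ι] [DecidableEq ι] [DecidableEq U]

/-- The injections `τ` of the role set `ι` into `X` in which each `τ a` has the label `a` towards
all the other `τ b`. Here `L u v` is the label of `u` in the pair `u, v`. -/
def labeledCopies (L : U → U → ι) (X : Finset U) : Finset (ι → U) :=
  (Fintype.piFinset fun _ => X).filter
    fun τ => Function.Injective τ ∧ ∀ a b, a ≠ b → L (τ a) (τ b) = a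

theorem mem_labeledCopies {L : U → U → ι} {X : Finset U} {τ : ι → U} :
    τ ∈ labeledCopies L X ↔
      (∀ a, τ a ∈ X) ∧ Function.Injective τ ∧ ∀ a b, a ≠ b → L (τ a) (τ b) = a := by
  simp [labeledCopies]

/-- The vertices of `X` towards which `u` has the label `a`. -/
def outNbhd (L : U → U → ι) (X : Finset U) (u : U) (a : ι) : Finset U :=
  (X.erase u).filter fun v => L u v = a

/-- The vertices `v` of `X` such that `u` has the label `a` and `v` has the label `c` in the pair
`u, v`. -/
def biNbhd (L : U → U → ι) (X : Finset U) (u : U) (a c : ι) : Finset U :=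
  (X.erase u).filter fun v => L u v = a ∧ L v u = c

variable (L : U → U → ι) (X : Finset U)

theorem sum_card_outNbhd {u : U} (hu : u ∈ X) : ∑ a, #(outNbhd L X u a) = #X - 1 := by
  rw [← card_erase_of_mem hu]
  exact (card_eq_sum_card_fiberwise (f := fun v => L u v) (t := univ) (by simp)).symm

theorem sum_card_biNbhd_le (u : U) (a : ι) (s : Finset ι) :
    ∑ c ∈ s, #(biNbhd L X u a c) ≤ #(outNbhd L X u a) := by
  calc ∑ c ∈ s, #(biNbhd L X u a c)
      ≤ ∑ c, #(biNbhd L X u a c) := sum_le_sum_of_subset (subset_univ s)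
    _ = #(outNbhd L X u a) := by
        rw [card_eq_sum_card_fiberwise (f := fun v => L v u) (t := univ) (by simp)]
        refine sum_congr rfl fun c _ => ?_
        rw [outNbhd, filter_filter, biNbhd]

theorem prod_card_biNbhd_le (u : U) (a : ι) (s : Finset ι) :
    (∏ c ∈ s, (#(biNbhd L X u a c) : ℝ)) ≤ ((#(outNbhd L X u a) : ℝ) / #s) ^ #s := by
  refine (prod_le_mean_pow_card s _ fun _ _ => Nat.cast_nonneg _).trans ?_
  have h : (∑ c ∈ s, (#(biNbhd L X u a c) : ℝ)) ≤ #(outNbhd L X u a) := by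
    exact_mod_cast sum_card_biNbhd_le L X u a s
  gcongr

theorem mem_biNbhd_of_mem_labeledCopies {L : U → U → ι} {X : Finset U} {τ : ι → U}
    (hτ : τ ∈ labeledCopies L X) {a c : ι} (h : c ≠ a) : τ c ∈ biNbhd L X (τ a) a c := by
  rw [mem_labeledCopies] at hτ
  simp only [biNbhd, mem_filter, mem_erase]
  exact ⟨⟨fun e => h (hτ.2.1 e), hτ.1 c⟩, hτ.2.2 a c h.symm, hτ.2.2 c a h⟩

/-- The number of copies in which `u` has the role `a`. -/
theorem card_copies_role_le (u : U) (a : ι) :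
    (#((labeledCopies L X).filter fun τ => τ a = u) : ℝ)
      ≤ ((#(outNbhd L X u a) : ℝ) / (Fintype.card ι - 1 : ℕ)) ^ (Fintype.card ι - 1) := by
  have hsub : (labeledCopies L X).filter (fun τ => τ a = u)
      ⊆ Fintype.piFinset fun c => if c = a then {u} else biNbhd L X u a c := by
    intro τ hτ
    obtain ⟨hτ', rfl⟩ := mem_filter.1 hτ
    rw [Fintype.mem_piFinset]
    intro c
    split_ifs with h
    · simp [h]
    · exact mem_biNbhd_of_mem_labeledCopies hτ' h
  have hcard : #(Fintype.piFinset fun c => if c = a then {u} else biNbhd L X u a c)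
      = ∏ c ∈ univ.erase a, #(biNbhd L X u a c) := by
    rw [Fintype.card_piFinset, ← mul_prod_erase univ _ (mem_univ a)]
    simp only [if_true, card_singleton, one_mul]
    exact prod_congr rfl fun c hc => by rw [if_neg (ne_of_mem_erase hc)]
  have h := prod_card_biNbhd_le L X u a (univ.erase a)
  rw [card_erase_of_mem (mem_univ a), card_univ] at h
  refine le_trans ?_ h
  exact_mod_cast (card_le_card hsub).trans hcard.le

/-- The number of copies in which `u` has the role `a` and `v` has the role `b`. -/
theorem card_copies_two_roles_le (u v : U) {a b : ι} (hab : a ≠ b) :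
    (#((labeledCopies L X).filter fun τ => τ a = u ∧ τ b = v) : ℝ)
      ≤ ((#(outNbhd L X u a) : ℝ) / (Fintype.card ι - 2 : ℕ)) ^ (Fintype.card ι - 2) := by
  have hsub : (labeledCopies L X).filter (fun τ => τ a = u ∧ τ b = v)
      ⊆ Fintype.piFinset fun c => if c = a then {u} else if c = b then {v}
        else biNbhd L X u a c := by
    intro τ hτ
    obtain ⟨hτ', rfl, rfl⟩ := mem_filter.1 hτ
    rw [Fintype.mem_piFinset]
    intro c
    split_ifs with h h'
    · simp [h]
    · simp [h']
    · exact mem_biNbhd_of_mem_labeledCopies hτ' h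
  have hcard : #(Fintype.piFinset fun c => if c = a then {u} else if c = b then {v}
        else biNbhd L X u a c) = ∏ c ∈ (univ.erase a).erase b, #(biNbhd L X u a c) := by
    rw [Fintype.card_piFinset, ← mul_prod_erase univ _ (mem_univ a),
      ← mul_prod_erase (univ.erase a) _ (mem_erase.2 ⟨hab.symm, mem_univ b⟩)]
    simp only [if_true, if_neg hab.symm, card_singleton, one_mul]
    exact prod_congr rfl fun c hc => by
      rw [if_neg (ne_of_mem_erase (mem_of_mem_erase hc)), if_neg (ne_of_mem_erase hc)]
  have h := prod_card_biNbhd_le L X u a ((univ.erase a).erase b)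
  rw [card_erase_of_mem (mem_erase.2 ⟨hab.symm, mem_univ b⟩), card_erase_of_mem (mem_univ a),
    card_univ, Nat.sub_sub] at h
  refine le_trans ?_ h
  exact_mod_cast (card_le_card hsub).trans hcard.le

/-- Deleting the vertex `u` loses only the copies through `u`, which are sorted here by the role
of `u`. -/
theorem card_labeledCopies_le_erase_add (u : U) :
    #(labeledCopies L X) ≤ #(labeledCopies L (X.erase u))
      + ∑ a, #((labeledCopies L X).filter fun τ => τ a = u) := by
  have hsub : labeledCopies L X ⊆ labeledCopies L (X.erase u) ∪
      univ.biUnion fun a => (labeledCopies L X).filter fun τ => τ a = u := by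
    intro τ hτ
    rw [mem_union]
    by_cases h : ∃ a, τ a = u
    · obtain ⟨a, ha⟩ := h
      exact Or.inr (mem_biUnion.2 ⟨a, mem_univ a, mem_filter.2 ⟨hτ, ha⟩⟩)
    · push Not at h
      rw [mem_labeledCopies] at hτ
      exact Or.inl (mem_labeledCopies.2 ⟨fun a => mem_erase.2 ⟨h a, hτ.1 a⟩, hτ.2⟩)
  exact (card_le_card hsub).trans ((card_union_le _ _).trans
    (add_le_add_right card_biUnion_le _))

end Labelings

/-! ### Dominant labels and wrong pairs -/

section Alignment

open Finset

/-- The vertices of `X` whose dominant label is `i`. -/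
def partClass {ι U : Type*} [DecidableEq ι] (X : Finset U) (part : U → ι) (i : ι) :
    Finset U :=
  X.filter fun u => part u = i

theorem sum_card_partClass {ι U : Type*} [Fintype ι] [DecidableEq ι] (X : Finset U)
    (part : U → ι) : ∑ i, #(partClass X part i) = #X :=
  (card_eq_sum_card_fiberwise (f := part) (t := univ) (by simp)).symm

variable {ι U : Type*} [Fintype ι] [DecidableEq ι] [DecidableEq U]

/-- The ordered pairs of vertices in distinct classes in which at least one of the two does not
have its dominant label. -/
def wrongPairs (L : U → U → ι) (X : Finset U) (part : U → ι) : Finset (U × U) :=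
  (X ×ˢ X).filter fun q =>
    part q.1 ≠ part q.2 ∧ (L q.1 q.2 ≠ part q.1 ∨ L q.2 q.1 ≠ part q.2)

variable (L : U → U → ι) (X : Finset U) (part : U → ι)

/-- Let `E` be a set of pairs between two classes. The transversals through a pair in `E` make up at
least the same fraction of all transversals as `E` does of all pairs. -/
theorem card_mul_prod_le_card_transversals (P : ι → Finset U) {i j : ι} (hij : i ≠ j)
    (E : Finset (U × U)) (hE : E ⊆ P i ×ˢ P j) :
    #E * ∏ l, #(P l) ≤
      #((Fintype.piFinset P).filter fun τ => (τ i, τ j) ∈ E) * (#(P i) * #(P j)) := by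
  rw [← Fintype.card_piFinset, ← card_product, ← card_product, ← card_product]
  -- Exchange the entries of `τ` in the classes `i` and `j` with the given pair.
  refine card_le_card_of_injOn
    (fun x => (Function.update (Function.update x.2 i x.1.1) j x.1.2, (x.2 i, x.2 j))) ?_ ?_
  · rintro ⟨⟨u, v⟩, τ⟩ h
    simp only [coe_product, Set.mem_prod, mem_coe, Fintype.mem_piFinset] at h
    have huv := mem_product.1 (hE h.1)
    simp only [coe_product, Set.mem_prod, mem_coe, mem_filter, Fintype.mem_piFinset]
    refine ⟨⟨fun l => ?_, ?_⟩, h.2 i, h.2 j⟩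
    · by_cases hj : l = j
      · subst hj; simpa using huv.2
      by_cases hi : l = i
      · subst hi; simpa [hj] using huv.1
      · simpa [hi, hj] using h.2 l
    · simpa [hij] using h.1
  · rintro ⟨⟨u, v⟩, τ⟩ - ⟨⟨u', v'⟩, τ'⟩ - h
    simp only [Prod.mk.injEq] at h
    obtain ⟨h, hi, hj⟩ := h
    have hl := fun l => congrFun h l
    have huu : u = u' := by simpa [hij] using hl i
    have hvv : v = v' := by simpa using hl j
    have hττ : τ = τ' := by
      funext l
      by_cases hlj : l = j
      · rw [hlj, hj]
      by_cases hli : l = i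
      · rw [hli, hi]
      · simpa [hli, hlj] using hl l
    rw [huu, hvv, hττ]

/-- Sum the bound of `card_mul_prod_le_card_transversals` over all pairs of classes. -/
theorem prod_mul_card_wrongPairs_le [Nonempty ι] :
    (∏ i, (#(partClass X part i) : ℝ)) * #(wrongPairs L X part) ≤
      #((Fintype.piFinset (partClass X part)).filter
          fun τ => ∃ i j, (τ i, τ j) ∈ wrongPairs L X part)
        * ((#X : ℝ) ^ 2 * ((Fintype.card ι - 1) / Fintype.card ι)) := by
  set P := partClass X part with hP
  set G := wrongPairs L X part with hG
  set T := (Fintype.piFinset P).filter fun τ => ∃ i j, (τ i, τ j) ∈ G with hT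
  have hpair : ∀ q : ι × ι, q.1 ≠ q.2 →
      (∏ i, (#(P i) : ℝ)) * #(G.filter fun x => (part x.1, part x.2) = q)
        ≤ #T * (#(P q.1) * #(P q.2)) := by
    rintro ⟨i, j⟩ hij
    have h := card_mul_prod_le_card_transversals P hij
      (G.filter fun x => (part x.1, part x.2) = (i, j)) (by
        rintro ⟨u, v⟩ h
        simp only [hG, wrongPairs, mem_filter, mem_product, Prod.mk.injEq] at h
        simp only [hP, partClass, mem_product, mem_filter]
        exact ⟨⟨h.1.1.1, h.2.1⟩, h.1.1.2, h.2.2⟩)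
    have h' : #((Fintype.piFinset P).filter fun τ =>
        (τ i, τ j) ∈ G.filter fun x => (part x.1, part x.2) = (i, j)) ≤ #T := by
      refine card_le_card fun τ hτ => ?_
      rw [mem_filter] at hτ ⊢
      exact ⟨hτ.1, i, j, (mem_filter.1 hτ.2).1⟩
    have h2 := h.trans (Nat.mul_le_mul_right _ h')
    rw [mul_comm]
    exact_mod_cast h2
  have hGsum : (#G : ℝ) = ∑ q ∈ (univ : Finset ι).offDiag,
      (#(G.filter fun x => (part x.1, part x.2) = q) : ℝ) := by
    have := card_eq_sum_card_fiberwise (s := G) (f := fun x => (part x.1, part x.2))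
      (t := (univ : Finset ι).offDiag) (by
        intro x hx
        simp only [hG, wrongPairs, mem_coe, mem_filter] at hx
        simpa using hx.2.1)
    exact_mod_cast this
  have hsum : ∑ i, (#(P i) : ℝ) = #X := by exact_mod_cast sum_card_partClass X part
  have hoff : ∑ q ∈ (univ : Finset ι).offDiag, (#(P q.1) : ℝ) * #(P q.2)
      = (#X : ℝ) ^ 2 - ∑ i, (#(P i) : ℝ) ^ 2 := by
    have h1 : ∑ q ∈ (univ : Finset ι) ×ˢ univ, (#(P q.1) : ℝ) * #(P q.2) = (#X : ℝ) ^ 2 := by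
      rw [sum_product, ← hsum, sq, sum_mul_sum]
    rw [← h1, ← diag_union_offDiag, sum_union (disjoint_diag_offDiag _), sum_diag]
    simp only [sq]
    ring
  have hcs : (#X : ℝ) ^ 2 ≤ Fintype.card ι * ∑ i, (#(P i) : ℝ) ^ 2 := by
    rw [← hsum, ← card_univ]
    exact sq_sum_le_card_mul_sum_sq
  have hk : (0 : ℝ) < Fintype.card ι := by exact_mod_cast Fintype.card_pos
  calc (∏ i, (#(P i) : ℝ)) * #G
      = ∑ q ∈ (univ : Finset ι).offDiag,
          (∏ i, (#(P i) : ℝ)) * #(G.filter fun x => (part x.1, part x.2) = q) := by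
        rw [hGsum, mul_sum]
    _ ≤ ∑ q ∈ (univ : Finset ι).offDiag, #T * ((#(P q.1) : ℝ) * #(P q.2)) :=
        sum_le_sum fun q hq => hpair q (mem_offDiag.1 hq).2.2
    _ = #T * ((#X : ℝ) ^ 2 - ∑ i, (#(P i) : ℝ) ^ 2) := by rw [← mul_sum, hoff]
    _ ≤ _ := by
        apply mul_le_mul_of_nonneg_left _ (Nat.cast_nonneg _)
        rw [mul_div_assoc', le_div_iff₀ hk]
        linarith

variable {L X part} {W : ℝ}

theorem card_outNbhd_le_of_ne (hW : ∀ u ∈ X, (#X : ℝ) - 1 - #(outNbhd L X u (part u)) ≤ W)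
    {u : U} (hu : u ∈ X) {a : ι} (ha : a ≠ part u) : (#(outNbhd L X u a) : ℝ) ≤ W := by
  have h := sum_card_outNbhd L X hu
  rw [← add_sum_erase univ _ (mem_univ (part u))] at h
  have h1 : #(outNbhd L X u a) ≤ ∑ c ∈ univ.erase (part u), #(outNbhd L X u c) :=
    single_le_sum (f := fun c => #(outNbhd L X u c)) (fun _ _ => Nat.zero_le _)
      (mem_erase.2 ⟨ha, mem_univ a⟩)
  have h2 : #(outNbhd L X u (part u)) + #(outNbhd L X u a) + 1 ≤ #X := by
    have := card_pos.2 ⟨u, hu⟩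
    omega
  have h3 : (#(outNbhd L X u (part u)) : ℝ) + #(outNbhd L X u a) + 1 ≤ #X := by exact_mod_cast h2
  linarith [hW u hu]

/-- If every vertex has its dominant label towards all but `W` vertices, then few copies contain a
vertex that does not play its dominant role. -/
theorem card_misaligned_le (hk : 2 ≤ Fintype.card ι) (hW0 : 0 ≤ W)
    (hW : ∀ u ∈ X, (#X : ℝ) - 1 - #(outNbhd L X u (part u)) ≤ W) :
    (#((labeledCopies L X).filter fun τ => ∃ a, part (τ a) ≠ a) : ℝ)
      ≤ #X * (W / (Fintype.card ι - 1 : ℕ)) ^ (Fintype.card ι - 1) := by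
  have hsub : (labeledCopies L X).filter (fun τ => ∃ a, part (τ a) ≠ a) ⊆
      X.biUnion fun u => (univ.erase (part u)).biUnion fun a =>
        (labeledCopies L X).filter fun τ => τ a = u := by
    intro τ hτ
    obtain ⟨hτ, a, ha⟩ := mem_filter.1 hτ
    exact mem_biUnion.2 ⟨τ a, (mem_labeledCopies.1 hτ).1 a, mem_biUnion.2
      ⟨a, mem_erase.2 ⟨ha.symm, mem_univ a⟩, mem_filter.2 ⟨hτ, rfl⟩⟩⟩
  have hcard : (#((labeledCopies L X).filter fun τ => ∃ a, part (τ a) ≠ a) : ℝ) ≤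
      ∑ u ∈ X, ∑ a ∈ univ.erase (part u), (#((labeledCopies L X).filter fun τ => τ a = u) : ℝ) := by
    have := (card_le_card hsub).trans (card_biUnion_le.trans
      (sum_le_sum fun u _ => card_biUnion_le))
    exact_mod_cast this
  refine hcard.trans ?_
  rw [← nsmul_eq_mul]
  refine sum_le_card_nsmul _ _ _ fun u hu => ?_
  obtain ⟨r, hr⟩ : ∃ r, Fintype.card ι - 1 = r + 1 := ⟨Fintype.card ι - 2, by omega⟩
  have hrest : ∑ a ∈ univ.erase (part u), (#(outNbhd L X u a) : ℝ) ≤ W := by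
    have h := sum_card_outNbhd L X hu
    rw [← add_sum_erase univ _ (mem_univ (part u))] at h
    have h1 : #(outNbhd L X u (part u))
        + ∑ a ∈ univ.erase (part u), #(outNbhd L X u a) + 1 = #X := by
      have := card_pos.2 ⟨u, hu⟩
      omega
    have h3 : (#(outNbhd L X u (part u)) : ℝ)
        + ∑ a ∈ univ.erase (part u), (#(outNbhd L X u a) : ℝ) + 1 = #X := by exact_mod_cast h1
    linarith [hW u hu]
  calc ∑ a ∈ univ.erase (part u), (#((labeledCopies L X).filter fun τ => τ a = u) : ℝ)
      ≤ ∑ a ∈ univ.erase (part u),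
          (#(outNbhd L X u a) : ℝ) * (W ^ r / ((Fintype.card ι - 1 : ℕ) : ℝ) ^ (r + 1)) := by
        refine sum_le_sum fun a ha => (card_copies_role_le L X u a).trans ?_
        rw [hr, div_pow, pow_succ (#(outNbhd L X u a) : ℝ), mul_comm (_ ^ r), mul_div_assoc]
        have := card_outNbhd_le_of_ne hW hu (ne_of_mem_erase ha)
        gcongr
    _ ≤ W * (W ^ r / ((Fintype.card ι - 1 : ℕ) : ℝ) ^ (r + 1)) := by
        rw [← sum_mul]
        gcongr
    _ = _ := by rw [hr, div_pow, pow_succ W, mul_comm (W ^ r), mul_div_assoc]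

/-- A copy that is neither aligned nor inside one class contains at least `2 * (k - 2)` ordered
wrong pairs, while a wrong pair lies in few copies: its two roles are determined by its labels, and
one of its vertices plays a role other than its dominant one. -/
theorem two_mul_card_bad_le (hW0 : 0 ≤ W)
    (hW : ∀ u ∈ X, (#X : ℝ) - 1 - #(outNbhd L X u (part u)) ≤ W) :
    (2 * (Fintype.card ι - 2) : ℕ) * (#((labeledCopies L X).filter fun τ =>
        (∃ a, part (τ a) ≠ a) ∧ ¬ ∃ i, ∀ a, part (τ a) = i) : ℝ)
      ≤ #(wrongPairs L X part) * (W / (Fintype.card ι - 2 : ℕ)) ^ (Fintype.card ι - 2) := by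
  set B := (labeledCopies L X).filter fun τ =>
        (∃ a, part (τ a) ≠ a) ∧ ¬ ∃ i, ∀ a, part (τ a) = i with hB
  set G := wrongPairs L X part with hG
  let r : (ι → U) → U × U → Prop := fun τ q => ∃ a b, a ≠ b ∧ τ a = q.1 ∧ τ b = q.2
  classical
  have hlow : ∀ τ ∈ B, 2 * (Fintype.card ι - 2) ≤ #(G.bipartiteAbove r τ) := by
    intro τ hτ
    obtain ⟨hτ, hne, hconst⟩ := mem_filter.1 hτ
    rw [mem_labeledCopies] at hτ
    refine (two_mul_le_card_cross_pairs (fun a => part (τ a)) hconst hne).trans ?_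
    refine card_le_card_of_injOn (fun q => (τ q.1, τ q.2)) ?_ ?_
    · rintro ⟨a, b⟩ h
      simp only [coe_filter, mem_univ, true_and, Set.mem_ofPred_eq] at h
      have hab : a ≠ b := fun e => h.1 (by rw [e])
      simp only [coe_bipartiteAbove, Set.mem_ofPred_eq, hG, wrongPairs, mem_filter, mem_product]
      refine ⟨⟨⟨hτ.1 a, hτ.1 b⟩, h.1, ?_⟩, a, b, hab, rfl, rfl⟩
      rw [hτ.2.2 a b hab, hτ.2.2 b a hab.symm]
      exact h.2.imp Ne.symm Ne.symm
    · rintro ⟨a, b⟩ - ⟨a', b'⟩ - h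
      simp only [Prod.mk.injEq] at h
      rw [hτ.2.1 h.1, hτ.2.1 h.2]
  have hup : ∀ q ∈ G, (#(B.bipartiteBelow r q) : ℝ)
      ≤ (W / (Fintype.card ι - 2 : ℕ)) ^ (Fintype.card ι - 2) := by
    rintro ⟨u, v⟩ hq
    simp only [hG, wrongPairs, mem_filter, mem_product] at hq
    obtain ⟨⟨hu, hv⟩, -, hwrong⟩ := hq
    rcases (B.bipartiteBelow r (u, v)).eq_empty_or_nonempty with h0 | ⟨τ₀, h0⟩
    · rw [h0, card_empty, Nat.cast_zero]
      positivity
    have hroles : ∀ τ ∈ B.bipartiteBelow r (u, v), τ ∈ labeledCopies L X ∧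
        τ (L u v) = u ∧ τ (L v u) = v ∧ L u v ≠ L v u := by
      intro τ hτ
      obtain ⟨hτ, a, b, hab, ha, hb⟩ := (mem_bipartiteBelow r).1 hτ
      obtain ⟨hτ, -⟩ := mem_filter.1 hτ
      have h := (mem_labeledCopies.1 hτ).2.2
      have h1 := h a b hab
      have h2 := h b a hab.symm
      simp only at ha hb
      rw [ha, hb] at h1 h2
      rw [h1, h2]
      exact ⟨hτ, ha, hb, hab⟩
    have hne := (hroles τ₀ h0).2.2.2
    rcases hwrong with hw | hw
    · have hsub : B.bipartiteBelow r (u, v) ⊆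
          (labeledCopies L X).filter fun τ => τ (L u v) = u ∧ τ (L v u) = v := fun τ hτ =>
        mem_filter.2 ⟨(hroles τ hτ).1, (hroles τ hτ).2.1, (hroles τ hτ).2.2.1⟩
      refine (Nat.cast_le.2 (card_le_card hsub)).trans
        ((card_copies_two_roles_le L X u v hne).trans ?_)
      have := card_outNbhd_le_of_ne hW hu hw
      gcongr
    · have hsub : B.bipartiteBelow r (u, v) ⊆
          (labeledCopies L X).filter fun τ => τ (L v u) = v ∧ τ (L u v) = u := fun τ hτ =>
        mem_filter.2 ⟨(hroles τ hτ).1, (hroles τ hτ).2.2.1, (hroles τ hτ).2.1⟩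
      refine (Nat.cast_le.2 (card_le_card hsub)).trans
        ((card_copies_two_roles_le L X v u hne.symm).trans ?_)
      have := card_outNbhd_le_of_ne hW hv hw
      gcongr
  have hcount := sum_card_bipartiteAbove_eq_sum_card_bipartiteBelow r (s := B) (t := G)
  have h1 : #B * (2 * (Fintype.card ι - 2)) ≤ ∑ τ ∈ B, #(G.bipartiteAbove r τ) := by
    rw [← smul_eq_mul]
    exact card_nsmul_le_sum _ _ _ hlow
  have h2 : ∑ q ∈ G, (#(B.bipartiteBelow r q) : ℝ)
      ≤ #G * (W / (Fintype.card ι - 2 : ℕ)) ^ (Fintype.card ι - 2) := by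
    rw [← nsmul_eq_mul]
    exact sum_le_card_nsmul _ _ _ hup
  have h3 : ((#B * (2 * (Fintype.card ι - 2)) : ℕ) : ℝ)
      ≤ ∑ q ∈ G, (#(B.bipartiteBelow r q) : ℝ) := by
    exact_mod_cast h1.trans hcount.le
  rw [Nat.cast_mul, mul_comm] at h3
  exact h3.trans h2

variable (L X part)

/-- An aligned copy is a transversal of the classes without wrong pairs. -/
theorem card_aligned_add_card_transversals_le :
    #((labeledCopies L X).filter fun τ => ¬ ∃ a, part (τ a) ≠ a)
      + #((Fintype.piFinset (partClass X part)).filter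
          fun τ => ∃ i j, (τ i, τ j) ∈ wrongPairs L X part)
      ≤ ∏ i, #(partClass X part i) := by
  rw [← Fintype.card_piFinset, ← card_union_of_disjoint]
  · refine card_le_card (union_subset (fun τ hτ => ?_) (filter_subset _ _))
    obtain ⟨hτ, h⟩ := mem_filter.1 hτ
    push Not at h
    exact Fintype.mem_piFinset.2 fun i =>
      mem_filter.2 ⟨(mem_labeledCopies.1 hτ).1 i, h i⟩
  · rw [disjoint_left]
    intro τ hτ hτ'
    obtain ⟨hτ, h⟩ := mem_filter.1 hτ
    push Not at h
    obtain ⟨-, i, j, hij⟩ := mem_filter.1 hτ'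
    simp only [wrongPairs, mem_filter, mem_product, h] at hij
    have hL := (mem_labeledCopies.1 hτ).2.2
    rcases hij.2.2 with h' | h'
    · exact h' (hL i j hij.2.1)
    · exact h' (hL j i hij.2.1.symm)

theorem card_inside_le :
    #((labeledCopies L X).filter fun τ => ∃ i, ∀ a, part (τ a) = i)
      ≤ ∑ i, #(labeledCopies L (partClass X part i)) := by
  refine (card_le_card (t := univ.biUnion fun i => labeledCopies L (partClass X part i))
    fun τ hτ => ?_).trans card_biUnion_le
  obtain ⟨hτ, i, hi⟩ := mem_filter.1 hτ
  rw [mem_labeledCopies] at hτ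
  exact mem_biUnion.2 ⟨i, mem_univ i, mem_labeledCopies.2
    ⟨fun a => mem_filter.2 ⟨hτ.1 a, hi a⟩, hτ.2⟩⟩

end Alignment

/-! ### The upper bound for labelings -/

section UpperBound

open Finset

variable {ι U : Type*} [Fintype ι] [DecidableEq ι] [DecidableEq U]

/-- A vertex whose deletion would not preserve the bound has a dominant label. -/
theorem exists_dominant_label (L : U → U → ι) {X : Finset U} {u : U} (hu : u ∈ X)
    (hk : 4 ≤ Fintype.card ι) (hX : 2 ≤ #X)
    (hM : (#X : ℝ) ^ Fintype.card ι / ((Fintype.card ι : ℝ) ^ Fintype.card ι - Fintype.card ι)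
      < #(labeledCopies L X))
    (ih : (#(labeledCopies L (X.erase u)) : ℝ) ≤ (#(X.erase u) : ℝ) ^ Fintype.card ι
      / ((Fintype.card ι : ℝ) ^ Fintype.card ι - Fintype.card ι)) :
    ∃ i, (#X : ℝ) - 1 - #(outNbhd L X u i) ≤ minorityBound (Fintype.card ι) * (#X - 1) := by
  set k := Fintype.card ι with hkdef
  have hX' : (2 : ℝ) ≤ #X := by exact_mod_cast hX
  have hcast : ((k - 1 : ℕ) : ℝ) = (k : ℝ) - 1 := by rw [Nat.cast_sub (by omega), Nat.cast_one]
  have hk1 : (0 : ℝ) < (k : ℝ) - 1 := by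
    have : (4 : ℝ) ≤ k := by exact_mod_cast hk
    linarith
  have hX1 : ((#X - 1 : ℕ) : ℝ) = (#X : ℝ) - 1 := by rw [Nat.cast_sub (by omega), Nat.cast_one]
  rw [card_erase_of_mem hu, hX1] at ih
  have hdel : (#(labeledCopies L X) : ℝ) ≤ #(labeledCopies L (X.erase u))
      + ∑ a, (#((labeledCopies L X).filter fun τ => τ a = u) : ℝ) := by
    exact_mod_cast card_labeledCopies_le_erase_add L X u
  have hdeg : ∑ a, (#((labeledCopies L X).filter fun τ => τ a = u) : ℝ)
      ≤ (∑ a, (#(outNbhd L X u a) : ℝ) ^ (k - 1)) / ((k : ℝ) - 1) ^ (k - 1) := by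
    rw [sum_div]
    refine sum_le_sum fun a _ => ?_
    rw [← div_pow, ← hcast]
    exact card_copies_role_le L X u a
  have hT := pow_div_le_pow_div_sub (k := k) (by omega) (n := (#X : ℝ)) (by linarith)
  refine exists_sub_le_minorityBound hk (fun a => (#(outNbhd L X u a) : ℝ))
    (fun _ => Nat.cast_nonneg _) (by linarith) ?_ ?_
  · rw [← hX1]
    exact_mod_cast sum_card_outNbhd L X hu
  · rw [mul_comm, ← le_div_iff₀ (pow_pos hk1 _)]
    linarith

/-- A set of `n` vertices contains at most `n ^ k / (k ^ k - k)` labeled copies. -/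
theorem card_labeledCopies_le (L : U → U → ι) (hk : 4 ≤ Fintype.card ι) (X : Finset U) :
    (#(labeledCopies L X) : ℝ) ≤ (#X : ℝ) ^ Fintype.card ι
      / ((Fintype.card ι : ℝ) ^ Fintype.card ι - Fintype.card ι) := by
  classical
  induction X using Finset.strongInduction with
  | H X ih =>
  by_contra! hM
  set k := Fintype.card ι with hkdef
  have : Nonempty ι := Fintype.card_pos_iff.1 (by omega)
  have hk4 : (4 : ℝ) ≤ k := by exact_mod_cast hk
  have hcast1 : ((k - 1 : ℕ) : ℝ) = (k : ℝ) - 1 := by rw [Nat.cast_sub (by omega), Nat.cast_one]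
  have hcast2 : ((k - 2 : ℕ) : ℝ) = (k : ℝ) - 2 := by
    rw [Nat.cast_sub (by omega), Nat.cast_ofNat]
  have hD : 0 < (k : ℝ) ^ k - k := sub_pos.2 (lt_self_pow₀ (by linarith) (by omega))
  have hX : k ≤ #X := by
    have h0 : (0 : ℝ) < #(labeledCopies L X) := lt_of_le_of_lt (by positivity) hM
    obtain ⟨τ, hτ⟩ := card_pos.1 (Nat.cast_pos.1 h0)
    rw [mem_labeledCopies] at hτ
    rw [hkdef, ← card_univ]
    exact card_le_card_of_injOn τ (fun a _ => hτ.1 a) hτ.2.1.injOn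
  have hn : (4 : ℝ) ≤ #X := by exact_mod_cast hk.trans hX
  -- Every vertex has a dominant label; these labels partition `X` into classes.
  have hdom : ∀ u, ∃ i, u ∈ X →
      (#X : ℝ) - 1 - #(outNbhd L X u i) ≤ minorityBound k * #X := by
    intro u
    by_cases hu : u ∈ X
    · obtain ⟨i, hi⟩ := exists_dominant_label L hu hk (by omega) hM (ih _ (erase_ssubset hu))
      refine ⟨i, fun _ => hi.trans ?_⟩
      exact mul_le_mul_of_nonneg_left (by linarith) (minorityBound_nonneg k)
    · exact ⟨Classical.arbitrary ι, fun h => absurd h hu⟩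
  choose part hpart using hdom
  have hW0 : 0 ≤ minorityBound k * #X := mul_nonneg (minorityBound_nonneg k) (by linarith)
  have hmis := card_misaligned_le (by omega) hW0 hpart
  have hbad := two_mul_card_bad_le hW0 hpart
  have hG := prod_mul_card_wrongPairs_le L X part
  have hAT : (#((labeledCopies L X).filter fun τ => ¬ ∃ a, part (τ a) ≠ a) : ℝ)
      + #((Fintype.piFinset (partClass X part)).filter
          fun τ => ∃ i j, (τ i, τ j) ∈ wrongPairs L X part)
      ≤ ∏ i, (#(partClass X part i) : ℝ) := by
    exact_mod_cast card_aligned_add_card_transversals_le L X part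
  have hins : (#((labeledCopies L X).filter fun τ => ∃ i, ∀ a, part (τ a) = i) : ℝ)
      ≤ ∑ i, (#(labeledCopies L (partClass X part i)) : ℝ) := by
    exact_mod_cast card_inside_le L X part
  have hsplit : (#((labeledCopies L X).filter fun τ => ∃ a, part (τ a) ≠ a) : ℝ)
      + #((labeledCopies L X).filter fun τ => ¬ ∃ a, part (τ a) ≠ a) = #(labeledCopies L X) := by
    exact_mod_cast card_filter_add_card_filter_not _
  have hsplit' : (#((labeledCopies L X).filter fun τ => ∃ a, part (τ a) ≠ a) : ℝ)
      ≤ #((labeledCopies L X).filter fun τ => ∃ i, ∀ a, part (τ a) = i)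
        + #((labeledCopies L X).filter fun τ =>
          (∃ a, part (τ a) ≠ a) ∧ ¬ ∃ i, ∀ a, part (τ a) = i) := by
    have : (labeledCopies L X).filter (fun τ => ∃ a, part (τ a) ≠ a) ⊆
        (labeledCopies L X).filter (fun τ => ∃ i, ∀ a, part (τ a) = i) ∪
          (labeledCopies L X).filter fun τ =>
            (∃ a, part (τ a) ≠ a) ∧ ¬ ∃ i, ∀ a, part (τ a) = i := by
      intro τ hτ
      simp only [mem_union, mem_filter] at hτ ⊢
      by_cases h : ∃ i, ∀ a, part (τ a) = i
      · exact Or.inl ⟨hτ.1, h⟩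
      · exact Or.inr ⟨hτ.1, hτ.2, h⟩
    exact_mod_cast (card_le_card this).trans (card_union_le _ _)
  set M : ℝ := (#(labeledCopies L X) : ℝ)
  set Mis : ℝ := (#((labeledCopies L X).filter fun τ => ∃ a, part (τ a) ≠ a) : ℝ)
  set A : ℝ := (#((labeledCopies L X).filter fun τ => ¬ ∃ a, part (τ a) ≠ a) : ℝ)
  set I : ℝ := (#((labeledCopies L X).filter fun τ => ∃ i, ∀ a, part (τ a) = i) : ℝ)
  set B : ℝ := (#((labeledCopies L X).filter fun τ =>
          (∃ a, part (τ a) ≠ a) ∧ ¬ ∃ i, ∀ a, part (τ a) = i) : ℝ)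
  set T : ℝ := (#((Fintype.piFinset (partClass X part)).filter
          fun τ => ∃ i j, (τ i, τ j) ∈ wrongPairs L X part) : ℝ)
  set G : ℝ := (#(wrongPairs L X part) : ℝ)
  set p : ℝ := ∏ i, (#(partClass X part i) : ℝ) with hp
  set n : ℝ := (#X : ℝ) with hndef
  set κ : ℝ := (minorityBound k / (k - 2)) ^ (k - 2) * ((k - 1) / (2 * k * (k - 2))) with hκ
  rw [hcast1] at hmis
  rw [Nat.cast_mul, hcast2, Nat.cast_ofNat] at hbad
  have hT0 : 0 ≤ T := Nat.cast_nonneg _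
  have hκ0 : 0 ≤ κ := by
    have := minorityBound_nonneg k
    have h2 : (0 : ℝ) < (k : ℝ) - 2 := by linarith
    have h1 : (0 : ℝ) < (k : ℝ) - 1 := by linarith
    positivity
  have hnk : 0 < n ^ k := pow_pos (by linarith) k
  -- Only few copies are not aligned, so that the classes have many transversals.
  have hpκ : κ * n ^ k < p := by
    have h1 : n * (minorityBound k * n / (k - 1)) ^ (k - 1)
        = (minorityBound k / (k - 1)) ^ (k - 1) * n ^ k := by
      obtain ⟨j, hj⟩ : ∃ j, k = j + 1 := ⟨k - 1, by omega⟩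
      rw [mul_div_right_comm, mul_pow, hj, Nat.add_sub_cancel]
      ring
    have h2 := mul_le_mul_of_nonneg_right (minorityBound_pow_add_pow_le hk) hnk.le
    rw [← hκ, add_mul, one_div_mul_eq_div, ← h1] at h2
    linarith
  have hp0 : 0 < p := lt_of_le_of_lt (by positivity) hpκ
  -- Hence the wrong pairs spoil at least as many transversals as there are copies of the third kind.
  have hBT : B ≤ T := by
    have h2 : (0 : ℝ) < (k : ℝ) - 2 := by linarith
    have h1 : p * (2 * ((k : ℝ) - 2) * B) ≤
        T * (n ^ 2 * ((k - 1) / k)) * (minorityBound k * n / (k - 2)) ^ (k - 2) := by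
      have hc : 0 ≤ (minorityBound k * n / ((k : ℝ) - 2)) ^ (k - 2) := by positivity
      calc p * (2 * ((k : ℝ) - 2) * B)
          ≤ p * (G * (minorityBound k * n / (k - 2)) ^ (k - 2)) :=
            mul_le_mul_of_nonneg_left hbad hp0.le
        _ = p * G * (minorityBound k * n / (k - 2)) ^ (k - 2) := by ring
        _ ≤ _ := mul_le_mul_of_nonneg_right hG hc
    have h3 : T * (n ^ 2 * ((k - 1) / k)) * (minorityBound k * n / (k - 2)) ^ (k - 2)
        = 2 * ((k : ℝ) - 2) * (T * (κ * n ^ k)) := by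
      have hnk2 : n ^ k = n ^ (k - 2) * n ^ 2 := by rw [← pow_add]; congr 1; omega
      rw [hκ, hnk2, mul_div_right_comm, mul_pow]
      have : (k : ℝ) ≠ 0 := by linarith
      generalize (minorityBound k / ((k : ℝ) - 2)) ^ (k - 2) = x
      field_simp
    have h4 : p * B ≤ T * (κ * n ^ k) := by
      rw [h3] at h1
      have : 2 * ((k : ℝ) - 2) * (p * B) ≤ 2 * ((k : ℝ) - 2) * (T * (κ * n ^ k)) := by linarith
      exact le_of_mul_le_mul_left this (by linarith)
    have h5 : p * B ≤ p * T := by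
      rw [mul_comm p T]
      exact h4.trans (mul_le_mul_of_nonneg_left hpκ.le hT0)
    exact le_of_mul_le_mul_left h5 hp0
  -- All classes are nonempty, hence proper, and the induction hypothesis applies to them.
  have hproper : ∀ i, partClass X part i ⊂ X := by
    intro i
    refine (filter_subset _ X).ssubset_of_ne fun he => ?_
    have : Nontrivial ι := Fintype.one_lt_card_iff_nontrivial.1 (by omega)
    obtain ⟨j, hj⟩ := exists_ne i
    have hj0 : (#(partClass X part j) : ℝ) ≠ 0 := fun h => hp0.ne' (prod_eq_zero (mem_univ j) h)
    obtain ⟨v, hv⟩ := card_pos.1 (Nat.pos_of_ne_zero (Nat.cast_ne_zero.1 hj0))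
    obtain ⟨hvX, hvj⟩ := mem_filter.1 hv
    have hvi : v ∈ partClass X part i := by rw [partClass, he]; exact hvX
    exact hj (hvj.symm.trans (mem_filter.1 hvi).2)
  have hins' : I ≤ (∑ i, (#(partClass X part i) : ℝ) ^ k) / ((k : ℝ) ^ k - k) := by
    rw [sum_div]
    exact hins.trans (sum_le_sum fun i _ => ih _ (hproper i))
  have hfin := prod_add_sum_pow_le_sum_pow (fun i => (#(partClass X part i) : ℝ))
    fun _ => Nat.cast_nonneg _
  have hsum : ∑ i, (#(partClass X part i) : ℝ) = n := by
    rw [hndef, ← sum_card_partClass X part, Nat.cast_sum]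
  rw [hsum, ← hkdef, ← hp] at hfin
  have hle : p + (∑ i, (#(partClass X part i) : ℝ) ^ k) / ((k : ℝ) ^ k - k)
      ≤ n ^ k / ((k : ℝ) ^ k - k) := by
    rw [le_div_iff₀ hD, add_mul, div_mul_cancel₀ _ hD.ne']
    linarith
  linarith

end UpperBound

/-! ### Copies in colored tournaments, and blow-ups -/

namespace ColoredTournament

section Copies

open Finset

variable {V W C : Type*}

/-- The color of the edge between two distinct vertices. -/
def edgeColor (H : ColoredTournament W C) (u v : W) (h : u ≠ v) : C := H.color.get u v h

theorem edgeColor_comm (H : ColoredTournament W C) {u v : W} (h : u ≠ v) :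
    H.edgeColor v u h.symm = H.edgeColor u v h :=
  SimpleGraph.EdgeLabeling.get_comm _ _ _

theorem isCopy_iff {R : ColoredTournament V C} {H : ColoredTournament W C} {S : Finset W} :
    R.IsCopy H S ↔ ∃ f : V ↪ W, Set.range f = (S : Set W) ∧
      (∀ u v, H.arc (f u) (f v) ↔ R.arc u v) ∧
      ∀ u v (h : u ≠ v), H.edgeColor (f u) (f v) (f.injective.ne h) = R.edgeColor u v h := by
  refine exists_congr fun f => and_congr_right fun _ => and_congr_right fun _ => ?_
  constructor
  · intro h u v huv
    exact congrFun h ⟨s(u, v), huv⟩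
  · intro h
    exact SimpleGraph.EdgeLabeling.ext_get fun u v huv => h u v huv

open Classical in
/-- The role that `u` plays in every copy of `R` through both `u` and `v`: the color of the edge
between `u` and `v` determines an edge of `R`, and its orientation tells which end `u` is. If there
is no such edge in `R`, or `u = v`, the value is arbitrary. -/
noncomputable def roleLabel [Nonempty V] (R : ColoredTournament V C) (H : ColoredTournament W C)
    (u v : W) : V :=
  if h : ∃ r s, ∃ (hrs : r ≠ s) (huv : u ≠ v), R.edgeColor r s hrs = H.edgeColor u v huv ∧
      (R.arc r s ↔ H.arc u v)
  then h.choose else Classical.arbitrary V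

theorem roleLabel_eq [Nonempty V] {R : ColoredTournament V C} (hR : Function.Injective R.color)
    {H : ColoredTournament W C} {f : V ↪ W} (harc : ∀ u v, H.arc (f u) (f v) ↔ R.arc u v)
    (hcol : ∀ u v (h : u ≠ v),
      H.edgeColor (f u) (f v) (f.injective.ne h) = R.edgeColor u v h) {a b : V} (hab : a ≠ b) :
    R.roleLabel H (f a) (f b) = a := by
  have hex : ∃ r s, ∃ (hrs : r ≠ s) (huv : f a ≠ f b),
      R.edgeColor r s hrs = H.edgeColor (f a) (f b) huv ∧ (R.arc r s ↔ H.arc (f a) (f b)) :=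
    ⟨a, b, hab, f.injective.ne hab, (hcol a b hab).symm, (harc a b).symm⟩
  rw [roleLabel, dif_pos hex]
  obtain ⟨s, hrs, huv, hc, ho⟩ := hex.choose_spec
  generalize hex.choose = r at *
  rw [hcol a b hab] at hc
  rw [harc] at ho
  have he : s(r, s) = s(a, b) := congrArg Subtype.val (hR hc)
  rw [Sym2.eq_iff] at he
  rcases he with ⟨h, -⟩ | ⟨rfl, rfl⟩
  · exact h
  · rcases R.arc_total _ _ hab with h | h
    · exact absurd h (R.arc_asymm _ _ (ho.2 h))
    · exact absurd (ho.1 h) (R.arc_asymm _ _ h)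

theorem numCopies_le_card_labeledCopies [Fintype V] [DecidableEq V] [Nonempty V] [Fintype W]
    [DecidableEq W] {R : ColoredTournament V C} (hR : Function.Injective R.color)
    (H : ColoredTournament W C) :
    R.numCopies H ≤ #(labeledCopies (R.roleLabel H) univ) := by
  have hsub : {S : Finset W | R.IsCopy H S}
      ⊆ (labeledCopies (R.roleLabel H) univ).image (fun τ => univ.image τ) := by
    intro S hS
    obtain ⟨f, hf, harc, hcol⟩ := isCopy_iff.1 hS
    rw [mem_coe, mem_image]
    refine ⟨f, mem_labeledCopies.2 ⟨fun _ => mem_univ _, f.injective, fun a b hab =>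
      roleLabel_eq hR harc hcol hab⟩, ?_⟩
    rw [← coe_inj, coe_image, coe_univ, Set.image_univ, hf]
  refine (Set.ncard_le_ncard hsub (Finset.finite_toSet _)).trans ?_
  rw [Set.ncard_coe_finset]
  exact card_image_le

theorem maxCopies_le [Fintype V] [Nonempty C] (hk : 4 ≤ Fintype.card V)
    {R : ColoredTournament V C} (hR : Function.Injective R.color) (s : ℕ) :
    (R.maxCopies s : ℝ) ≤ (s : ℝ) ^ Fintype.card V
      / ((Fintype.card V : ℝ) ^ Fintype.card V - Fintype.card V) := by
  classical
  have : Nonempty V := Fintype.card_pos_iff.1 (by omega)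
  obtain ⟨H, hH⟩ := (R.maxCopies_isGreatest s).1
  rw [← hH]
  have h := card_labeledCopies_le (R.roleLabel H) hk univ
  rw [card_univ, Fintype.card_fin] at h
  exact (Nat.cast_le.2 (numCopies_le_card_labeledCopies hR H)).trans h

end Copies

section BlowUp

variable {V W W' C : Type*}

/-- The coloring and the orientation on `W'` that the embedding `e` into `W` induces. -/
def comap (H : ColoredTournament W C) (e : W' ↪ W) : ColoredTournament W' C where
  arc u v := H.arc (e u) (e v)
  arc_irrefl v := H.arc_irrefl (e v)
  arc_total u v h := H.arc_total (e u) (e v) (e.injective.ne h)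
  arc_asymm u v := H.arc_asymm (e u) (e v)
  color := .mk (fun u v h => H.edgeColor (e u) (e v) (e.injective.ne h))
    fun _ _ h => H.edgeColor_comm (e.injective.ne h)

theorem edgeColor_comap (H : ColoredTournament W C) (e : W' ↪ W) {u v : W'} (h : u ≠ v) :
    (H.comap e).edgeColor u v h = H.edgeColor (e u) (e v) (e.injective.ne h) :=
  rfl

theorem numCopies_le_maxCopies [Nonempty C] [Fintype W] (R : ColoredTournament V C)
    (H : ColoredTournament W C) : R.numCopies H ≤ R.maxCopies (Fintype.card W) := by
  classical
  let e : Fin (Fintype.card W) ≃ W := (Fintype.equivFin W).symm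
  refine le_trans ?_ ((R.maxCopies_isGreatest (Fintype.card W)).2 ⟨H.comap e.toEmbedding, rfl⟩)
  refine Set.ncard_le_ncard_of_injOn (fun S => S.map e.symm.toEmbedding) ?_ ?_ (Set.toFinite _)
  · intro S hS
    obtain ⟨f, hf, harc, hcol⟩ := isCopy_iff.1 hS
    refine isCopy_iff.2 ⟨f.trans e.symm.toEmbedding, ?_, fun u v => ?_, fun u v h => ?_⟩
    · rw [Function.Embedding.coe_trans, Set.range_comp, hf, Finset.coe_map]
    · simp [comap, harc]
    · rw [← hcol u v h, edgeColor_comap]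
      simp
  · exact (Finset.map_injective _).injOn

variable {n : V → Type*}

open Classical in
/-- The blow-up of `R` in which each vertex `a` is replaced by the colored tournament `H a`. -/
noncomputable def blowUp (R : ColoredTournament V C) (H : ∀ a, ColoredTournament (n a) C) :
    ColoredTournament (Σ a, n a) C where
  arc x y := R.arc x.1 y.1 ∨ ∃ h : x.1 = y.1, (H y.1).arc (h ▸ x.2) y.2
  arc_irrefl x h := by
    rcases h with h | ⟨_, h⟩
    · exact R.arc_irrefl _ h
    · exact (H x.1).arc_irrefl _ h
  arc_total := by
    rintro ⟨a, x⟩ ⟨b, y⟩ hne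
    by_cases hab : a = b
    · subst hab
      have hxy : x ≠ y := fun h => hne (by rw [h])
      exact ((H a).arc_total x y hxy).imp (fun h => Or.inr ⟨rfl, h⟩) fun h => Or.inr ⟨rfl, h⟩
    · exact (R.arc_total a b hab).imp Or.inl Or.inl
  arc_asymm := by
    rintro ⟨a, x⟩ ⟨b, y⟩ (h | ⟨hab, h⟩) (h' | ⟨hab', h'⟩)
    · exact R.arc_asymm _ _ h h'
    · simp only at hab'
      subst hab'
      exact R.arc_irrefl _ h
    · simp only at hab
      subst hab
      exact R.arc_irrefl _ h'
    · simp only at hab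
      subst hab
      exact (H a).arc_asymm _ _ h h'
  color := .mk (fun x y hne =>
      if h : x.1 = y.1 then
        (H y.1).edgeColor (h ▸ x.2) y.2 (fun e => hne (Sigma.ext h (by rw [← e]; simp)))
      else R.edgeColor x.1 y.1 h) (by
    rintro ⟨a, x⟩ ⟨b, y⟩ hne
    by_cases hab : a = b
    · subst hab
      simpa using (H a).edgeColor_comm _
    · simpa [hab, Ne.symm hab] using R.edgeColor_comm hab)

variable {R : ColoredTournament V C} {H : ∀ a, ColoredTournament (n a) C}

theorem blowUp_arc_mk_self {a : V} {x y : n a} :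
    (R.blowUp H).arc ⟨a, x⟩ ⟨a, y⟩ ↔ (H a).arc x y :=
  ⟨fun h => h.elim (fun h => absurd h (R.arc_irrefl a)) fun ⟨_, h⟩ => h,
    fun h => Or.inr ⟨rfl, h⟩⟩

theorem blowUp_arc_of_ne {a b : V} (hab : a ≠ b) {x : n a} {y : n b} :
    (R.blowUp H).arc ⟨a, x⟩ ⟨b, y⟩ ↔ R.arc a b :=
  ⟨fun h => h.elim id fun ⟨h, _⟩ => absurd h hab, Or.inl⟩

theorem blowUp_edgeColor_mk_self {a : V} {x y : n a} (h : x ≠ y)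
    (h' : (⟨a, x⟩ : Σ a, n a) ≠ ⟨a, y⟩) :
    (R.blowUp H).edgeColor ⟨a, x⟩ ⟨a, y⟩ h' = (H a).edgeColor x y h :=
  dif_pos rfl

theorem blowUp_edgeColor_of_ne {a b : V} (hab : a ≠ b) {x : n a} {y : n b}
    (h' : (⟨a, x⟩ : Σ a, n a) ≠ ⟨b, y⟩) :
    (R.blowUp H).edgeColor ⟨a, x⟩ ⟨b, y⟩ h' = R.edgeColor a b hab :=
  dif_neg hab

theorem isCopy_blowUp_map {a : V} {S : Finset (n a)} (hS : R.IsCopy (H a) S) :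
    R.IsCopy (R.blowUp H) (S.map (Function.Embedding.sigmaMk a)) := by
  obtain ⟨f, hf, harc, hcol⟩ := isCopy_iff.1 hS
  refine isCopy_iff.2 ⟨f.trans (Function.Embedding.sigmaMk a), ?_, fun u v => ?_, fun u v h => ?_⟩
  · rw [Function.Embedding.coe_trans, Set.range_comp, hf, Finset.coe_map]
  · exact blowUp_arc_mk_self.trans (harc u v)
  · exact (blowUp_edgeColor_mk_self (f.injective.ne h) _).trans (hcol u v h)

/-- The choice of a vertex in each part of a blow-up, as an embedding. -/
def sectionEmbedding (t : ∀ a, n a) : V ↪ Σ a, n a :=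
  ⟨fun a => ⟨a, t a⟩, fun _ _ h => congrArg Sigma.fst h⟩

theorem isCopy_blowUp_section [Fintype V] (t : ∀ a, n a) :
    R.IsCopy (R.blowUp H) (Finset.univ.map (sectionEmbedding t)) := by
  refine isCopy_iff.2 ⟨sectionEmbedding t, by simp, fun u v => ?_, fun u v h => ?_⟩
  · by_cases h : u = v
    · subst h
      exact iff_of_false ((R.blowUp H).arc_irrefl _) (R.arc_irrefl _)
    · exact blowUp_arc_of_ne h
  · exact blowUp_edgeColor_of_ne h _

/-- A blow-up contains the copies inside its parts and all transversals of its parts. -/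
theorem sum_numCopies_add_prod_le_numCopies_blowUp [Fintype V] (hV : 2 ≤ Fintype.card V)
    [∀ a, Fintype (n a)] :
    ∑ a, R.numCopies (H a) + ∏ a, Fintype.card (n a) ≤ R.numCopies (R.blowUp H) := by
  classical
  have : Nontrivial V := Fintype.one_lt_card_iff_nontrivial.1 hV
  have hne : ∀ {a : V} {S : Finset (n a)}, R.IsCopy (H a) S → S.Nonempty := by
    rintro a S ⟨f, hf, -⟩
    rw [← Finset.coe_nonempty, ← hf]
    exact Set.range_nonempty f
  let F : (Σ a, {S : Finset (n a) | R.IsCopy (H a) S}) ⊕ (∀ a, n a) →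
      {S : Finset (Σ a, n a) | R.IsCopy (R.blowUp H) S} :=
    Sum.elim (fun x => ⟨x.2.1.map (Function.Embedding.sigmaMk x.1), isCopy_blowUp_map x.2.2⟩)
      fun t => ⟨Finset.univ.map (sectionEmbedding t), isCopy_blowUp_section t⟩
  have hF : Function.Injective F := by
    refine Function.Injective.sumElim ?_ ?_ ?_
    · rintro ⟨a, S, hS⟩ ⟨b, S', hS'⟩ h
      have h : S.map (Function.Embedding.sigmaMk a) = S'.map (Function.Embedding.sigmaMk b) :=
        congrArg Subtype.val h
      obtain ⟨x, hx⟩ := hne hS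
      have hx' : (⟨a, x⟩ : Σ a, n a) ∈ S'.map (Function.Embedding.sigmaMk b) := by
        rw [← h]
        exact Finset.mem_map_of_mem (Function.Embedding.sigmaMk a) hx
      obtain ⟨y, -, hy⟩ := Finset.mem_map.1 hx'
      obtain rfl : b = a := congrArg Sigma.fst hy
      obtain rfl := Finset.map_injective _ h
      rfl
    · intro t t' h
      have h : Finset.univ.map (sectionEmbedding t) = Finset.univ.map (sectionEmbedding t') :=
        congrArg Subtype.val h
      funext a
      have ha : sectionEmbedding t a ∈ Finset.univ.map (sectionEmbedding t') := by
        rw [← h]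
        exact Finset.mem_map_of_mem _ (Finset.mem_univ a)
      obtain ⟨b, -, hb⟩ := Finset.mem_map.1 ha
      obtain rfl : b = a := congrArg Sigma.fst hb
      exact (eq_of_heq (Sigma.mk.inj hb).2).symm
    · rintro ⟨a, S, hS⟩ t h
      have h : S.map (Function.Embedding.sigmaMk a) = Finset.univ.map (sectionEmbedding t) :=
        congrArg Subtype.val h
      obtain ⟨b, hb⟩ := exists_ne a
      have hb' : sectionEmbedding t b ∈ S.map (Function.Embedding.sigmaMk a) := by
        rw [h]
        exact Finset.mem_map_of_mem _ (Finset.mem_univ b)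
      obtain ⟨y, -, hy⟩ := Finset.mem_map.1 hb'
      exact hb (congrArg Sigma.fst hy).symm
  have hcard := Nat.card_le_card_of_injective F hF
  rw [Nat.card_sum, Nat.card_sigma, Nat.card_pi] at hcard
  simp only [Nat.card_eq_fintype_card (α := n _)] at hcard
  exact hcard

theorem recursiveEdges_le_maxCopies [Fintype V] [Nonempty C] (hV : 2 ≤ Fintype.card V)
    (R : ColoredTournament V C) (s : ℕ) :
    recursiveEdges (Fintype.card V) s ≤ R.maxCopies s := by
  induction s using Nat.strong_induction_on with
  | _ s ih =>
  rw [recursiveEdges]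
  split_ifs with hs
  · exact Nat.zero_le _
  refine Finset.sup_le fun p hp => ?_
  have hsum : ∑ i, (p i : ℕ) = s := (Finset.mem_filter.1 hp).2
  let e := Fintype.equivFin V
  choose H hH using fun a => (R.maxCopies_isGreatest (p (e a))).1
  have hcard : Fintype.card (Σ a, Fin (p (e a))) = s := by
    rw [Fintype.card_sigma]
    simp only [Fintype.card_fin]
    exact (e.sum_comp fun i => (p i : ℕ)).trans hsum
  have h := (sum_numCopies_add_prod_le_numCopies_blowUp (R := R) (H := H) hV).trans
    (numCopies_le_maxCopies R _)
  rw [hcard] at h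
  refine le_trans ?_ h
  rw [← e.sum_comp, ← e.prod_comp fun i => (p i : ℕ)]
  simp only [Fintype.card_fin, hH]
  exact Nat.add_le_add_right (Finset.sum_le_sum fun a _ => ih _ (p (e a)).isLt) _

end BlowUp

end ColoredTournament

/-! ### Growth of `recursiveEdges`, and the limits -/

section RecursiveEdges

open Finset

theorem sum_recursiveEdges_add_prod_le {k s : ℕ} (hks : k ≤ s) (p : Fin k → ℕ)
    (hp : ∀ i, p i < s) (hsum : ∑ i, p i = s) :
    ∑ i, recursiveEdges k (p i) + ∏ i, p i ≤ recursiveEdges k s := by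
  rw [recursiveEdges.eq_1 k s, if_neg hks.not_gt]
  exact le_sup (s := univ.filter fun p : Fin k → Fin s => ∑ i, (p i : ℕ) = s)
    (f := fun p => ∑ i, recursiveEdges k (p i : ℕ) + ∏ i, (p i : ℕ)) (b := fun i => ⟨p i, hp i⟩)
    (by simpa using hsum)

/-- The parts of a balanced partition of `s`. -/
theorem exists_balanced {k s : ℕ} (hk : 4 ≤ k) (hks : k ≤ s) :
    ∃ p : Fin k → ℕ, ∑ i, p i = s ∧ ∀ i, p i < s ∧ s < k * p i + k := by
  refine ⟨fun i => s / k + if (i : ℕ) < s % k then 1 else 0, ?_, fun i => ⟨?_, ?_⟩⟩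
  · have hcard : #{i : Fin k | (i : ℕ) < s % k} = s % k := by
      rw [Fin.card_filter_val_lt, min_eq_right (Nat.mod_lt s (by omega)).le]
    rw [sum_add_distrib, sum_boole, hcard]
    simpa using Nat.div_add_mod s k
  · have := Nat.div_le_div_left hk (by norm_num : 0 < 4) (a := s)
    dsimp only
    split_ifs <;> omega
  · have h := Nat.div_add_mod s k
    have h' := Nat.mod_lt s (by omega : k > 0)
    have : k * (s / k) ≤ k * (s / k + if (i : ℕ) < s % k then 1 else 0) :=
      Nat.mul_le_mul_left k (Nat.le_add_right _ _)
    dsimp only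
    omega

/-- A lower bound on `recursiveEdges` with the right leading term. The shift by `2 * k` makes
induction along balanced partitions possible: it gains more in the term `∏ p i` than rounding and
the shifts in the terms `recursiveEdges k (p i)` lose. -/
theorem le_recursiveEdges {k : ℕ} (hk : 4 ≤ k) (s : ℕ) :
    max ((s : ℝ) - 2 * k) 0 ^ k / ((k : ℝ) ^ k - k) ≤ recursiveEdges k s := by
  induction s using Nat.strong_induction_on with
  | _ s ih =>
  have hk4 : (4 : ℝ) ≤ k := by exact_mod_cast hk
  have hk0 : (0 : ℝ) < k := by linarith
  rcases le_or_gt (s : ℝ) (2 * k) with hs | hs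
  · rw [max_eq_right (by linarith), zero_pow (by omega), zero_div]
    exact Nat.cast_nonneg _
  have hks : k ≤ s := by
    have : (k : ℝ) ≤ s := by linarith
    exact_mod_cast this
  obtain ⟨p, hsum, hp⟩ := exists_balanced hk hks
  have hrec : (∑ i, (recursiveEdges k (p i) : ℝ)) + ∏ i, (p i : ℝ) ≤ recursiveEdges k s := by
    exact_mod_cast sum_recursiveEdges_add_prod_le hks p (fun i => (hp i).1) hsum
  obtain ⟨j, rfl⟩ : ∃ j, k = j + 1 := ⟨k - 1, by omega⟩
  rw [max_eq_left (by linarith)]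
  set K : ℝ := ((j + 1 : ℕ) : ℝ) with hK
  set z : ℝ := s - 2 * K with hz
  have hz0 : 0 < z := by linarith
  set c : ℝ := 2 * K ^ 2 - K - 1 with hc
  have hc0 : 0 ≤ c := by nlinarith
  have hKj : 1 + c ≤ K ^ j := by
    have : K ^ 3 ≤ K ^ j := pow_le_pow_right₀ (by linarith) (by omega)
    nlinarith [mul_nonneg (sub_nonneg.2 hk4) (sq_nonneg K)]
  have hD : 0 < K ^ (j + 1) - K := by
    rw [pow_succ]
    nlinarith
  have hplow : ∀ i, (z + K + 1) / K ≤ p i := by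
    intro i
    rw [div_le_iff₀ hk0]
    have h : s + 1 ≤ (j + 1) * p i + (j + 1) := (hp i).2
    have h' : (s : ℝ) + 1 ≤ K * p i + K := by rw [hK]; exact_mod_cast h
    linarith
  have hprod : (z ^ (j + 1) + K * z ^ j * (K + 1)) / K ^ (j + 1) ≤ ∏ i, (p i : ℝ) := by
    have h1 := pow_add_mul_le_add_pow (a := z) (b := K + 1) hz0.le (by linarith) (j + 1)
    rw [Nat.add_sub_cancel, ← hK] at h1
    calc _ ≤ ((z + K + 1) / K) ^ (j + 1) := by
          rw [div_pow, add_assoc z]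
          gcongr
      _ = ∏ _i : Fin (j + 1), (z + K + 1) / K := by rw [prod_const, card_univ, Fintype.card_fin]
      _ ≤ _ := prod_le_prod (fun _ _ => by positivity) fun i _ => hplow i
  have hterm : ∀ i, (z ^ (j + 1) - K * z ^ j * c) / K ^ (j + 1) / (K ^ (j + 1) - K)
      ≤ recursiveEdges (j + 1) (p i) := by
    intro i
    refine le_trans ?_ (ih (p i) (hp i).1)
    apply div_le_div_of_nonneg_right _ hD.le
    have h1 : max (z - c) 0 / K ≤ max ((p i : ℝ) - 2 * K) 0 := by
      rw [div_le_iff₀ hk0]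
      refine max_le ?_ (by positivity)
      have h2 := hplow i
      rw [div_le_iff₀ hk0] at h2
      have h3 : ((p i : ℝ) - 2 * K) * K ≤ max ((p i : ℝ) - 2 * K) 0 * K :=
        mul_le_mul_of_nonneg_right (le_max_left _ _) hk0.le
      nlinarith
    refine le_trans ?_ (pow_le_pow_left₀ (by positivity) h1 _)
    rw [div_pow]
    apply div_le_div_of_nonneg_right _ (by positivity)
    rcases le_or_gt c z with hcz | hcz
    · have h2 := pow_add_mul_le_add_pow (a := z) (b := -c) hz0.le (by linarith) (j + 1)
      rw [Nat.add_sub_cancel, ← hK] at h2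
      rw [max_eq_left (by linarith), sub_eq_add_neg z c]
      linarith
    · refine le_trans ?_ (pow_nonneg (le_max_right _ _) _)
      rw [pow_succ]
      have : 0 ≤ z ^ j := by positivity
      nlinarith [mul_le_mul_of_nonneg_left hcz.le this, mul_nonneg this hc0]
  have hsumlow : K * ((z ^ (j + 1) - K * z ^ j * c) / K ^ (j + 1) / (K ^ (j + 1) - K))
      ≤ ∑ i, (recursiveEdges (j + 1) (p i) : ℝ) := by
    have := card_nsmul_le_sum univ (fun i => (recursiveEdges (j + 1) (p i) : ℝ)) _
      fun i _ => hterm i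
    rwa [card_univ, Fintype.card_fin, nsmul_eq_mul] at this
  refine le_trans ?_ ((add_le_add hsumlow hprod).trans hrec)
  have hKp : 0 < K ^ (j + 1) := by positivity
  have e : K * ((z ^ (j + 1) - K * z ^ j * c) / K ^ (j + 1) / (K ^ (j + 1) - K))
      + (z ^ (j + 1) + K * z ^ j * (K + 1)) / K ^ (j + 1)
      = (z ^ (j + 1) + K * z ^ j * ((K + 1) * (K ^ (j + 1) - K) - K * c) / K ^ (j + 1))
        / (K ^ (j + 1) - K) := by
    field_simp
    ring
  rw [e]
  apply div_le_div_of_nonneg_right _ hD.le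
  have h1 : 0 ≤ (K + 1) * (K ^ (j + 1) - K) - K * c := by
    have : K * c ≤ K ^ (j + 1) - K := by
      rw [pow_succ]
      nlinarith
    nlinarith
  have h2 : 0 ≤ K * z ^ j * ((K + 1) * (K ^ (j + 1) - K) - K * c) / K ^ (j + 1) := by positivity
  linarith

end RecursiveEdges

section Limits

theorem tendsto_pow_div_choose (k : ℕ) :
    Tendsto (fun s : ℕ => (s : ℝ) ^ k / (s.choose k : ℝ)) atTop (𝓝 k.factorial) := by
  have hk : (k.factorial : ℝ) ≠ 0 := by exact_mod_cast k.factorial_ne_zero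
  have h := (Asymptotics.isEquivalent_iff_tendsto_one ?_).1 (isEquivalent_choose k).symm
  · have h' := h.const_mul (k.factorial : ℝ)
    rw [mul_one] at h'
    refine h'.congr fun s => ?_
    rw [Pi.div_apply, div_right_comm, mul_div_cancel₀ _ hk]
  · filter_upwards [eventually_ge_atTop k] with s hs
    exact_mod_cast (Nat.choose_pos hs).ne'

theorem tendsto_max_sub_pow_div_choose (k : ℕ) (b : ℝ) :
    Tendsto (fun s : ℕ => max ((s : ℝ) - b) 0 ^ k / (s.choose k : ℝ)) atTop
      (𝓝 k.factorial) := by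
  have h1 : Tendsto (fun s : ℕ => 1 - b / (s : ℝ)) atTop (𝓝 1) := by
    simpa using (tendsto_const_div_atTop_nhds_zero_nat b).const_sub 1
  have h2 := (h1.pow k).mul (tendsto_pow_div_choose k)
  rw [one_pow, one_mul] at h2
  refine h2.congr' ?_
  filter_upwards [eventually_gt_atTop 0, eventually_ge_atTop ⌈b⌉₊] with s hs hb
  have hs' : (s : ℝ) ≠ 0 := by exact_mod_cast hs.ne'
  rw [max_eq_left (sub_nonneg.2 (Nat.ceil_le.1 hb)), mul_div_assoc', ← mul_pow, sub_mul, one_mul,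
    div_mul_cancel₀ _ hs']

end Limits

theorem theorem4 {V : Type*} [Fintype V] (k : ℕ) (hk : 4 ≤ k) (hV : Fintype.card V = k)
    (R : ColoredTournament V (PairColor k)) (hR : Function.Injective R.color) :
    R.HasInducibility ((k.factorial : ℝ) / ((k : ℝ) ^ k - k)) ∧
      Tendsto (fun s : ℕ => (recursiveEdges k s : ℝ) / (s.choose k : ℝ)) atTop
        (𝓝 ((k.factorial : ℝ) / ((k : ℝ) ^ k - k))) := by
  subst hV
  have : Nonempty (PairColor (Fintype.card V)) :=
    ⟨⟨{⟨0, by omega⟩, ⟨1, by omega⟩}, Finset.card_pair fun h => zero_ne_one (congrArg Fin.val h)⟩⟩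
  have hlow := (tendsto_max_sub_pow_div_choose (Fintype.card V)
    (2 * (Fintype.card V : ℝ))).div_const ((Fintype.card V : ℝ) ^ Fintype.card V - Fintype.card V)
  have hupp := (tendsto_pow_div_choose (Fintype.card V)).div_const
    ((Fintype.card V : ℝ) ^ Fintype.card V - Fintype.card V)
  have h1 : ∀ s : ℕ, max ((s : ℝ) - 2 * (Fintype.card V : ℝ)) 0 ^ Fintype.card V
        / (s.choose (Fintype.card V) : ℝ) / ((Fintype.card V : ℝ) ^ Fintype.card V - Fintype.card V)
      ≤ (recursiveEdges (Fintype.card V) s : ℝ) / (s.choose (Fintype.card V) : ℝ) := fun s => by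
    rw [div_right_comm]
    exact div_le_div_of_nonneg_right (le_recursiveEdges hk s) (Nat.cast_nonneg _)
  have h2 : ∀ s : ℕ, (recursiveEdges (Fintype.card V) s : ℝ) / (s.choose (Fintype.card V) : ℝ)
      ≤ (R.maxCopies s : ℝ) / (s.choose (Fintype.card V) : ℝ) := fun s =>
    div_le_div_of_nonneg_right
      (Nat.cast_le.2 (ColoredTournament.recursiveEdges_le_maxCopies (by omega) R s))
      (Nat.cast_nonneg _)
  have h3 : ∀ s : ℕ, (R.maxCopies s : ℝ) / (s.choose (Fintype.card V) : ℝ)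
      ≤ (s : ℝ) ^ Fintype.card V / (s.choose (Fintype.card V) : ℝ)
        / ((Fintype.card V : ℝ) ^ Fintype.card V - Fintype.card V) := fun s => by
    rw [div_right_comm]
    exact div_le_div_of_nonneg_right (ColoredTournament.maxCopies_le hk hR s) (Nat.cast_nonneg _)
  exact ⟨tendsto_of_tendsto_of_tendsto_of_le_of_le hlow hupp (fun s => (h1 s).trans (h2 s)) h3,
    tendsto_of_tendsto_of_tendsto_of_le_of_le hlow hupp h1 fun s => (h2 s).trans (h3 s)⟩
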